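/- Let $A$ be a unital $C^*$-algebra. Let $\mathcal L$ be the class of pairs $(B,E)$, where $B$ is a unital $C^*$-algebra containing $A$ as a $C^*$-subalgebra with the same unit and $E:B\to A$ is a conditional expectation of $B$ onto $A$ (a positive linear $A$-bimodule map with $E(a)=a$ for $a\in A$) with Watatani index $\operatorname{Index}E=2$. That is, there are $u_1,\dots,u_n,v_1,\dots,v_n\in B$ with $\sum_i u_iE(v_ix)=x=\sum_i E(xu_i)v_i$ for all $x\in B$ and $\sum_i u_iv_i=2$. Write $(B,E)\sim(B_1,E_1)$ if there is a $*$-isomorphism $\pi:B\to B_1$ with $\pi(a)=a$ for all $a\in A$ and $E_1\circ\pi=E$. Let $\mathcal M$ be the class of involutive $A$-$A$-equivalence bimodules. These are the $A$-$A$-equivalence bimodules $X$ (complete $A$-$A$-bimodules with full left and right $A$-valued inner products ${}_A\langle\cdot,\cdot\rangle$ and $\langle\cdot,\cdot\rangle_A$ that make $X$ a left and a right Hilbert $A$-module, with ${}_A\langle x\cdot a,y\rangle={}_A\langle x,y\cdot a^*\rangle$, $\langle a\cdot x,y\rangle_A=\langle x,a^*\cdot y\rangle_A$ and ${}_A\langle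 x,y\rangle\cdot z=x\cdot\langle y,z\rangle_A$) together with a conjugate linear map $x\mapsto x^\sharp$ on $X$ such that $(x^\sharp)^\sharp=x$, $(a\cdot x\cdot b)^\sharp=b^*\cdot x^\sharp\cdot a^*$ and ${}_A\langle x,y^\sharp\rangle=\langle x^\sharp,y\rangle_A$. Write $X\sim Y$ if there is a linear bijection $\rho:X\to Y$ that preserves both $A$-actions and both inner products and satisfies $\rho(x^\sharp)=\rho(x)^\sharp$. For $(B,E)\in\mathcal L$, regard $B$ as a right Hilbert $A$-module with inner product $\langle x,y\rangle=E(x^*y)$. Let $e_A$ be the Jones projection $b\mapsto E(b)$ on it, and let $C^*\langle B,e_A\rangle$ be the basic construction, the norm closure of the linear span of the operators $be_Ac$ $(b,c\in B)$. Let $\widehat\beta$ be the automorphism of $C^*\langle B,e_A\rangle$ that fixes $B$ and sends $e_A$ to $1-e_A$, that is, $\widehat\beta(b+c(2e_A-1))=b-c(2e_A-1)$ for $b,c\in B$. Let $X_B=e_AC^*\langle B,e_A\rangle(1-e_A)$, with $a\cdot x\cdot b=axb$, with ${}_A\langle x,y\rangle$ the element of $A$ such that ${}_A\langle x,y\rangle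 e_A=xy^*$, with $\langle x,y\rangle_A$ the element of $A$ such that $\langle x,y\rangle_A(1-e_A)=x^*y$, and with $x^\sharp=\widehat\beta(x^*)$. Let $B_-=\{b\in B: E(b)=0\}$, with the $A$-actions by multiplication, ${}_A\langle x,y\rangle=E(xy^*)$, $\langle x,y\rangle_A=E(x^*y)$ and $x^\sharp=x^*$. For $X\in\mathcal M$, let $\widetilde X$ be the dual bimodule and let $$L=\left\{\begin{bmatrix}a&x\\ \widetilde y&b\end{bmatrix}: a,b\in A,\ x,y\in X\right\}$$ be the linking algebra, with the operator norm of its action on the right Hilbert $A$-module $X\oplus A$. Let $$B_X=\left\{\begin{bmatrix}a&x\\ \widetilde{x^\sharp}&a\end{bmatrix}: a\in A,\ x\in X\right\}\subset L,\qquad E_X\left(\begin{bmatrix}a&x\\ \widetilde{x^\sharp}&a\end{bmatrix}\right)=\begin{bmatrix}a&0\\0&a\end{bmatrix},$$ where $A$ is embedded in $B_X$ by $a\mapsto\begin{bmatrix}a&0\\0&a\end{bmatrix}$. Then $X_B\in\mathcal M$, $B_-\in\mathcal M$ and $X_B\sim B_-$ for every $(B,E)\in\mathcal L$, and $(B_X,E_X)\in\mathcal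 L$ for every $X\in\mathcal M$. The map $[B,E]\mapsto[X_B]=[B_-]$ is a well-defined bijection of $\mathcal L/{\sim}$ onto $\mathcal M/{\sim}$, and its inverse is $[X]\mapsto[B_X,E_X]$. -/

import Mathlib

universe u

/-! ### Conditional expectations and their index -/

section CondExp

variable {A B : Type u} [CStarAlgebra A] [CStarAlgebra B]

/-- `E` is a conditional expectation of `B` onto the unital C⋆-subalgebra `A`, embedded in `B` by
the unital ⋆-homomorphism `ι`: a positive linear `A`-bimodule projection. An element of a
C⋆-algebra is positive iff it has the form `c⋆ c`. -/
structure IsConditionalExpectation (ι : A →⋆ₐ[ℂ] B) (E : B →ₗ[ℂ] A) : Prop where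
  apply_incl : ∀ a : A, E (ι a) = a
  bimodule : ∀ (a : A) (b : B) (a' : A), E (ι a * b * ι a') = a * E b * a'
  positive : ∀ b : B, ∃ c : A, E (star b * b) = star c * c

/-- The finite family `(u i, v i)` is a quasi-basis for `E`. -/
def IsQuasiBasis (ι : A →⋆ₐ[ℂ] B) (E : B →ₗ[ℂ] A) {n : ℕ} (u v : Fin n → B) : Prop :=
  (∀ x : B, ∑ i, u i * ι (E (v i * x)) = x) ∧ (∀ x : B, ∑ i, ι (E (x * u i)) * v i = x)

/-- `Index E = t` in the sense of Watatani: `E` has a finite quasi-basis `(u i, v i)` and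
`∑ u i * v i = t` (this sum is the same for all quasi-bases). -/
def HasIndex (ι : A →⋆ₐ[ℂ] B) (E : B →ₗ[ℂ] A) (t : B) : Prop :=
  ∃ (n : ℕ) (u v : Fin n → B), IsQuasiBasis ι E u v ∧ ∑ i, u i * v i = t

/-- The norm `‖E(x⋆x)‖^{1/2}` of the right Hilbert `A`-module `B` with the inner product
`⟨x, y⟩ = E(x⋆y)`. -/
noncomputable def moduleNorm (E : B →ₗ[ℂ] A) (x : B) : ℝ := √‖E (star x * x)‖

/-- If `E` has a finite quasi-basis, then the module norm is equivalent to the norm of `B`. So `B`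
is complete in the module norm, and is itself the Hilbert `A`-module of `E`. -/
theorem moduleNorm_equivalent {ι : A →⋆ₐ[ℂ] B} {E : B →ₗ[ℂ] A}
    (hE : IsConditionalExpectation ι E) {n : ℕ} {u v : Fin n → B} (h : IsQuasiBasis ι E u v) :
    ∃ C : ℝ, 0 < C ∧ ∀ x : B, moduleNorm E x ≤ C * ‖x‖ ∧ ‖x‖ ≤ C * moduleNorm E x := by
  let _ : PartialOrder A := CStarAlgebra.spectralOrder A
  have _ : StarOrderedRing A := CStarAlgebra.spectralOrderedRing A
  let _ : PartialOrder B := CStarAlgebra.spectralOrder B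
  have _ : StarOrderedRing B := CStarAlgebra.spectralOrderedRing B
  have pos : ∀ b : B, 0 ≤ b → 0 ≤ E b := by
    intro b hb
    obtain ⟨d, rfl⟩ := CStarAlgebra.nonneg_iff_eq_star_mul_self.mp hb
    obtain ⟨c, hc⟩ := hE.positive d
    rw [hc]
    exact star_mul_self_nonneg c
  have hstar : ∀ b : B, E (star b) = star (E b) := fun b => map_star (PositiveLinearMap.mk₀ E pos) b
  have hcl : ∀ x y : B, moduleNorm E (x * y) ≤ ‖x‖ * moduleNorm E y := by
    intro x y
    unfold moduleNorm
    rw [show ‖x‖ = √(‖x‖ ^ 2) from (Real.sqrt_sq (norm_nonneg x)).symm,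
      ← Real.sqrt_mul (by positivity)]
    apply Real.sqrt_le_sqrt
    have h1 : star (x * y) * (x * y) ≤ (‖x‖ ^ 2 : ℝ) • (star y * y) := by
      have := CStarAlgebra.star_left_conjugate_le_norm_smul (a := y) (b := star x * x)
        (hb := IsSelfAdjoint.star_mul_self x)
      rw [CStarRing.norm_star_mul_self, ← pow_two] at this
      simpa [mul_assoc] using this
    have h2 : E (star (x * y) * (x * y)) ≤ (‖x‖ ^ 2 : ℝ) • E (star y * y) := by
      have := pos _ (sub_nonneg.mpr h1)
      rw [map_sub, sub_nonneg] at this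
      rwa [show E ((‖x‖ ^ 2 : ℝ) • (star y * y)) = (‖x‖ ^ 2 : ℝ) • E (star y * y) from
        (E.restrictScalars ℝ).map_smul _ _] at this
    have h3 := CStarAlgebra.norm_le_norm_of_nonneg_of_le (pos _ (star_mul_self_nonneg (x * y))) h2
    rwa [norm_smul, Real.norm_of_nonneg (by positivity)] at h3
  have hmod : ∀ x : B, ‖E x‖ ≤ moduleNorm E x := by
    intro x
    apply Real.le_sqrt_of_sq_le
    rw [pow_two, ← CStarRing.norm_star_mul_self]
    refine CStarAlgebra.norm_le_norm_of_nonneg_of_le (star_mul_self_nonneg _) ?_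
    have h0 := pos _ (star_mul_self_nonneg (x - ι (E x)))
    have e1 : E (star x * ι (E x)) = star (E x) * E x := by
      simpa [hstar] using hE.bimodule 1 (star x) (E x)
    have e2 : E (ι (star (E x)) * x) = star (E x) * E x := by
      simpa using hE.bimodule (star (E x)) x 1
    have e3 : E (ι (star (E x)) * ι (E x)) = star (E x) * E x := by
      rw [← map_mul, hE.apply_incl]
    have e4 : star (x - ι (E x)) * (x - ι (E x)) = star x * x - star x * ι (E x)
        - (ι (star (E x)) * x - ι (star (E x)) * ι (E x)) := by
      rw [star_sub, ← map_star]
      noncomm_ring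
    rw [e4, map_sub, map_sub, map_sub, e1, e2, e3, sub_self, sub_zero] at h0
    exact sub_nonneg.mp h0
  have hι : ∀ a : A, ‖ι a‖ ≤ ‖a‖ := fun a => NonUnitalStarAlgHom.norm_apply_le ι a
  have hS : 0 ≤ ∑ i, ‖u i‖ * ‖v i‖ := by positivity
  have hM : 0 ≤ moduleNorm E (1 : B) := Real.sqrt_nonneg _
  refine ⟨1 + moduleNorm E (1 : B) + ∑ i, ‖u i‖ * ‖v i‖, by positivity, fun x => ⟨?_, ?_⟩⟩
  · have := hcl x 1
    rw [mul_one] at this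
    nlinarith [norm_nonneg x, mul_nonneg hS (norm_nonneg x)]
  · have hx : 0 ≤ moduleNorm E x := Real.sqrt_nonneg _
    have : ‖x‖ ≤ (∑ i, ‖u i‖ * ‖v i‖) * moduleNorm E x := by
      conv_lhs => rw [← h.1 x]
      refine (norm_sum_le _ _).trans ?_
      rw [Finset.sum_mul]
      refine Finset.sum_le_sum fun i _ => (norm_mul_le _ _).trans ?_
      rw [mul_assoc]
      exact mul_le_mul_of_nonneg_left ((hι _).trans ((hmod _).trans (hcl _ _))) (norm_nonneg _)
    nlinarith [mul_nonneg hM hx]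

end CondExp

/-- A pair `(B, E)`: a unital C⋆-algebra `B` containing `A` as a unital C⋆-subalgebra (through the
injective unital ⋆-homomorphism `ι`), and a conditional expectation `E` of `B` onto `A` with
`Index E = 2`. -/
structure IndexTwoExtension (A : Type u) [CStarAlgebra A] where
  B : Type u
  [cstar : CStarAlgebra B]
  ι : A →⋆ₐ[ℂ] B
  ι_injective : Function.Injective ι
  E : B →ₗ[ℂ] A
  condExp : IsConditionalExpectation ι E
  index_two : HasIndex ι E 2

attribute [instance] IndexTwoExtension.cstar

/-- `(B, E) ∼ (B₁, E₁)`: there is a ⋆-isomorphism `π : B → B₁` that fixes `A` and satisfies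
`E₁ ∘ π = E`. -/
def IndexTwoExtension.Equiv {A : Type u} [CStarAlgebra A] (P Q : IndexTwoExtension A) : Prop :=
  ∃ π : P.B ≃⋆ₐ[ℂ] Q.B, (∀ a, π (P.ι a) = Q.ι a) ∧ (∀ b, Q.E (π b) = P.E b)

instance IndexTwoExtension.setoid (A : Type u) [CStarAlgebra A] :
    Setoid (IndexTwoExtension A) where
  r := IndexTwoExtension.Equiv
  iseqv :=
    { refl := fun _ => ⟨StarAlgEquiv.refl ℂ _, fun _ => rfl, fun _ => rfl⟩
      symm := by
        rintro P Q ⟨π, h1, h2⟩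
        refine ⟨π.symm, fun a => ?_, fun b => ?_⟩
        · rw [← h1, π.symm_apply_apply]
        · rw [← h2, π.apply_symm_apply]
      trans := by
        rintro P Q R ⟨π, h1, h2⟩ ⟨σ, h3, h4⟩
        refine ⟨π.trans σ, fun a => ?_, fun b => ?_⟩
        · rw [StarAlgEquiv.trans_apply, h1, h3]
        · rw [StarAlgEquiv.trans_apply, h4, h2] }

/-! ### Equivalence bimodules and involutions -/

/-- An `A`-`A`-equivalence (imprimitivity) bimodule: an `A`-`A`-bimodule which is a full left
Hilbert `A`-module for `linner` and a full right Hilbert `A`-module for `rinner` (complete in the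
norm of the inner products), such that `A` acts on either side by adjointable operators of the
other side and `linner x y • z = x • rinner y z`. The right action of `a` is the action of
`MulOpposite.op a`. -/
structure EquivBimodule (A : Type u) [CStarAlgebra A] where
  X : Type u
  [normedGroup : NormedAddCommGroup X]
  [normedSpace : NormedSpace ℂ X]
  [complete : CompleteSpace X]
  [leftModule : Module A X]
  [rightModule : Module Aᵐᵒᵖ X]
  [bimodule : SMulCommClass A Aᵐᵒᵖ X]
  [leftScalar : IsScalarTower ℂ A X]
  [rightScalar : IsScalarTower ℂ Aᵐᵒᵖ X]
  /-- The left `A`-valued inner product, linear in the first variable. -/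
  linner : X → X → A
  /-- The right `A`-valued inner product, linear in the second variable. -/
  rinner : X → X → A
  linner_add_left : ∀ x y z, linner (x + y) z = linner x z + linner y z
  linner_smul_left : ∀ (a : A) (x y : X), linner (a • x) y = a * linner x y
  star_linner : ∀ x y, star (linner x y) = linner y x
  linner_self_nonneg : ∀ x, ∃ c : A, linner x x = star c * c
  norm_sq_eq_linner : ∀ x, ‖x‖ ^ 2 = ‖linner x x‖
  linner_full : Dense (Submodule.span ℂ {c : A | ∃ x y, linner x y = c} : Set A)
  rinner_add_right : ∀ x y z, rinner x (y + z) = rinner x y + rinner x z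
  rinner_smul_right : ∀ (x y : X) (a : A), rinner x (MulOpposite.op a • y) = rinner x y * a
  star_rinner : ∀ x y, star (rinner x y) = rinner y x
  rinner_self_nonneg : ∀ x, ∃ c : A, rinner x x = star c * c
  norm_sq_eq_rinner : ∀ x, ‖x‖ ^ 2 = ‖rinner x x‖
  rinner_full : Dense (Submodule.span ℂ {c : A | ∃ x y, rinner x y = c} : Set A)
  linner_op_smul : ∀ (x y : X) (a : A),
    linner (MulOpposite.op a • x) y = linner x (MulOpposite.op (star a) • y)
  rinner_smul : ∀ (a : A) (x y : X), rinner (a • x) y = rinner x (star a • y)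
  linner_smul_eq : ∀ x y z, linner x y • z = MulOpposite.op (rinner y z) • x

attribute [instance] EquivBimodule.normedGroup EquivBimodule.normedSpace EquivBimodule.complete
  EquivBimodule.leftModule EquivBimodule.rightModule EquivBimodule.bimodule
  EquivBimodule.leftScalar EquivBimodule.rightScalar

/-- An involutive `A`-`A`-equivalence bimodule, with its conjugate linear involution `x ↦ x♯`. -/
structure InvolutiveBimodule (A : Type u) [CStarAlgebra A] extends EquivBimodule A where
  sharp : X →ₗ⋆[ℂ] X
  sharp_sharp : ∀ x, sharp (sharp x) = x
  sharp_smul_smul : ∀ (a : A) (x : X) (b : A),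
    sharp (a • MulOpposite.op b • x) = star b • MulOpposite.op (star a) • sharp x
  linner_sharp : ∀ x y, linner x (sharp y) = rinner (sharp x) y

/-- `X ∼ Y`: there is an isomorphism of `A`-`A`-equivalence bimodules (a linear bijection that
preserves both actions and both inner products) that commutes with the involutions. -/
def InvolutiveBimodule.Equiv {A : Type u} [CStarAlgebra A] (X Y : InvolutiveBimodule A) : Prop :=
  ∃ ρ : X.X ≃ₗ[ℂ] Y.X,
    (∀ (a : A) (x : X.X), ρ (a • x) = a • ρ x) ∧
    (∀ (x : X.X) (a : A), ρ (MulOpposite.op a • x) = MulOpposite.op a • ρ x) ∧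
    (∀ x y, Y.linner (ρ x) (ρ y) = X.linner x y) ∧
    (∀ x y, Y.rinner (ρ x) (ρ y) = X.rinner x y) ∧
    (∀ x, ρ (X.sharp x) = Y.sharp (ρ x))

instance InvolutiveBimodule.setoid (A : Type u) [CStarAlgebra A] :
    Setoid (InvolutiveBimodule A) where
  r := InvolutiveBimodule.Equiv
  iseqv :=
    { refl := fun X => ⟨LinearEquiv.refl ℂ X.X, by simp⟩
      symm := by
        rintro X Y ⟨ρ, h1, h2, h3, h4, h5⟩
        refine ⟨ρ.symm, fun a x => ?_, fun x a => ?_, fun x y => ?_, fun x y => ?_, fun x => ?_⟩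
        · apply ρ.injective; rw [h1]; simp
        · apply ρ.injective; rw [h2]; simp
        · rw [← h3]; simp
        · rw [← h4]; simp
        · apply ρ.injective; rw [h5]; simp
      trans := by
        rintro X Y Z ⟨ρ, h1, h2, h3, h4, h5⟩ ⟨σ, k1, k2, k3, k4, k5⟩
        exact ⟨ρ.trans σ, by simp [h1, k1], by simp [h2, k2], by simp [h3, k3], by simp [h4, k4],
          by simp [h5, k5]⟩ }

/-! ### The basic construction and its corner -/

namespace IndexTwoExtension

variable {A : Type u} [CStarAlgebra A] (P : IndexTwoExtension A)

/-- `b ∈ B` as the operator of left multiplication on the Hilbert `A`-module `B`. -/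
noncomputable def lam (b : P.B) : Module.End ℂ P.B := LinearMap.mulLeft ℂ b

/-- The Jones projection `e_A`: the operator `b ↦ E(b)` on the Hilbert `A`-module `B`. -/
noncomputable def jones : Module.End ℂ P.B := P.ι.toAlgHom.toLinearMap ∘ₗ P.E

/-- The C⋆-basic construction `C⋆⟨B, e_A⟩`: the closure, in the operator norm of the Hilbert
`A`-module `B`, of the linear span of the operators `b e_A c` with `b, c ∈ B`. -/
def basicConstruction : Set (Module.End ℂ P.B) :=
  {T | ∀ ε : ℝ, 0 < ε → ∃ S ∈ Submodule.span ℂ {R | ∃ b c, R = P.lam b * P.jones * P.lam c},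
    ∀ x, moduleNorm P.E ((T - S) x) ≤ ε * moduleNorm P.E x}

/-- `S = T⋆` as operators on the Hilbert `A`-module `B`: `⟨T x, y⟩ = ⟨x, S y⟩` for the inner product
`⟨x, y⟩ = E(x⋆y)`. -/
def IsAdjoint (T S : Module.End ℂ P.B) : Prop :=
  ∀ x y, P.E (star (T x) * y) = P.E (star x * S y)

/-- `T' = β̂(T)` for the dual action `β̂` on `C⋆⟨B, e_A⟩ ≅ B ⋊_β ℤ₂`: every element has the form
`b + c U` with `b, c ∈ B` and the self-adjoint unitary `U = 2 e_A - 1`, which implements `β`, and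
`β̂(b + c U) = b - c U`. So `β̂` is the automorphism which fixes `B` and maps `e_A` to
`1 - e_A`. -/
def IsDualAction (T T' : Module.End ℂ P.B) : Prop :=
  ∃ b c : P.B, T = P.lam b + P.lam c * (2 * P.jones - 1) ∧
    T' = P.lam b - P.lam c * (2 * P.jones - 1)

/-- An isomorphism `ρ` from the involutive `A`-`A`-equivalence bimodule `X` onto the corner
`X_B = e_A C⋆⟨B, e_A⟩ (1 - e_A)` with `a · x · b = a x b`, left inner product `ψ⁻¹(x y⋆)` for
`ψ(a) = a e_A`, right inner product `φ⁻¹(x⋆ y)` for `φ(a) = a (1 - e_A)`, and involution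
`x♯ = β̂(x⋆)`. Here `ρadj x` is the operator `(ρ x)⋆`. -/
structure CornerIso (X : InvolutiveBimodule A) where
  ρ : X.X →ₗ[ℂ] Module.End ℂ P.B
  ρadj : X.X → Module.End ℂ P.B
  isAdjoint : ∀ x, P.IsAdjoint (ρ x) (ρadj x)
  injective : Function.Injective ρ
  range_eq : Set.range ρ =
    {T | ∃ S ∈ P.basicConstruction, T = P.jones * S * (1 - P.jones)}
  map_smul_left : ∀ (a : A) (x : X.X), ρ (a • x) = P.lam (P.ι a) * ρ x
  map_smul_right : ∀ (x : X.X) (a : A), ρ (MulOpposite.op a • x) = ρ x * P.lam (P.ι a)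
  linner_eq : ∀ x y, P.lam (P.ι (X.linner x y)) * P.jones = ρ x * ρadj y
  rinner_eq : ∀ x y, P.lam (P.ι (X.rinner x y)) * (1 - P.jones) = ρadj x * ρ y
  map_sharp : ∀ x, P.IsDualAction (ρadj x) (ρ (X.sharp x))

/-- An isomorphism `ρ` from the involutive `A`-`A`-equivalence bimodule `X` onto
`B₋ = {b ∈ B | E(b) = 0}` with the actions by multiplication, inner products `E(x y⋆)` and
`E(x⋆ y)`, and involution `x♯ = x⋆`. -/
structure KernelIso (X : InvolutiveBimodule A) where
  ρ : X.X →ₗ[ℂ] P.B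
  injective : Function.Injective ρ
  range_eq : Set.range ρ = {b | P.E b = 0}
  map_smul_left : ∀ (a : A) (x : X.X), ρ (a • x) = P.ι a * ρ x
  map_smul_right : ∀ (x : X.X) (a : A), ρ (MulOpposite.op a • x) = ρ x * P.ι a
  linner_eq : ∀ x y, X.linner x y = P.E (ρ x * star (ρ y))
  rinner_eq : ∀ x y, X.rinner x y = P.E (star (ρ x) * ρ y)
  map_sharp : ∀ x, ρ (X.sharp x) = star (ρ x)

end IndexTwoExtension

/-! ### The linking algebra and the algebra of a bimodule -/

/-- The linking algebra of `X`, that is, the matrices `[[a, x], [ỹ, b]]` with `a, b ∈ A` and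
`x, y ∈ X`, where `ỹ` is `y` viewed as an element of the dual bimodule. (It needs no completion,
since `X` is complete.) -/
@[ext] structure LinkingAlgebra {A : Type u} [CStarAlgebra A] (X : EquivBimodule A) where
  a : A
  x : X.X
  y : X.X
  b : A

namespace LinkingAlgebra

variable {A : Type u} [CStarAlgebra A] {X : EquivBimodule A}

instance : Add (LinkingAlgebra X) := ⟨fun m n => ⟨m.a + n.a, m.x + n.x, m.y + n.y, m.b + n.b⟩⟩

/-- On the dual bimodule, `z • ỹ` is the class of `conj z • y`. -/
instance : SMul ℂ (LinkingAlgebra X) := ⟨fun z m => ⟨z • m.a, z • m.x, star z • m.y, z • m.b⟩⟩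

/-- The matrix product, where `x · ỹ = linner x y`, `ỹ · x = rinner y x`, and `ỹ · a`, `b · ỹ` are
the classes of `a⋆ · y` and `y · b⋆`. -/
instance : Mul (LinkingAlgebra X) :=
  ⟨fun m n =>
    { a := m.a * n.a + X.linner m.x n.y
      x := m.a • n.x + MulOpposite.op n.b • m.x
      y := star n.a • m.y + MulOpposite.op (star m.b) • n.y
      b := X.rinner m.y n.x + m.b * n.b }⟩

instance : Star (LinkingAlgebra X) := ⟨fun m => ⟨star m.a, m.y, m.x, star m.b⟩⟩

/-- The action of `[[a, x], [ỹ, b]]` on the right Hilbert `A`-module `X ⊕ A`. -/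
def act (m : LinkingAlgebra X) (v : X.X × A) : X.X × A :=
  (m.a • v.1 + MulOpposite.op v.2 • m.x, X.rinner m.y v.1 + m.b * v.2)

/-- The norm of the right Hilbert `A`-module `X ⊕ A`. -/
noncomputable def sumNorm (v : X.X × A) : ℝ := √‖X.rinner v.1 v.1 + star v.2 * v.2‖

/-- `c` is the norm of `m`, that is, its operator norm on `X ⊕ A`. -/
def IsNorm (m : LinkingAlgebra X) (c : ℝ) : Prop :=
  IsLeast {r : ℝ | 0 ≤ r ∧ ∀ v : X.X × A, sumNorm (m.act v) ≤ r * sumNorm v} c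

end LinkingAlgebra

/-- An isomorphism `π` from `(B, E)` onto `(B_X, E_X)`: an isometric ⋆-isomorphism of `B` onto the
C⋆-subalgebra `B_X = {[[a, x], [(x♯)~, a]]}` of the linking algebra of `X` that maps `a ∈ A` to
`[[a, 0], [0, a]]` and carries `E` to
`E_X : [[a, x], [(x♯)~, a]] ↦ [[a, 0], [0, a]]`. -/
structure InvolutiveBimodule.LinkingIso {A : Type u} [CStarAlgebra A] (X : InvolutiveBimodule A)
    (P : IndexTwoExtension A) where
  π : P.B → LinkingAlgebra X.toEquivBimodule
  map_add : ∀ b c, π (b + c) = π b + π c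
  map_smul : ∀ (z : ℂ) (b : P.B), π (z • b) = z • π b
  map_mul : ∀ b c, π (b * c) = π b * π c
  map_star : ∀ b, π (star b) = star (π b)
  isNorm : ∀ b, (π b).IsNorm ‖b‖
  injective : Function.Injective π
  range_eq : Set.range π = {m | ∃ (a : A) (x : X.X), m = ⟨a, x, X.sharp x, a⟩}
  map_incl : ∀ a : A, π (P.ι a) = ⟨a, 0, 0, a⟩
  map_expectation : ∀ b, π (P.ι (P.E b)) = ⟨(π b).a, 0, 0, (π b).a⟩

/-! Write `B = A ⊕ B₋` with `B₋ = ker E`. Everything rests on one fact, `ι_E_mul`: if `Index E = 2`,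
then `B₋ B₋ ⊆ A`, so that `B` is `ℤ₂`-graded with even part `A`.

To see this, project a quasi-basis to `B₋`. The index drops by `1`, which leaves `u i, v i ∈ B₋`
with `∑ u i * v i = 1`. The Gram matrix `H i j = E (v i * star (v j))` is positive, and `u H u⋆ =
1`. For `x ∈ B₋` and `c j = E (star (u j) * x)` one has `x = u H c` and `c⋆ H c = E (x⋆x)`, so
Cauchy–Schwarz for the row `u` gives `x⋆x ≤ E (x⋆x)`. The difference is positive and `E` kills it,
so it vanishes because `E` is faithful. Polarization gives `x⋆y = E (x⋆y)` on `B₋`.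

It follows that `B₋`, with the norm of `B`, is an involutive equivalence bimodule; fullness comes
from `∑ u i * v i = 1`. Conversely `B_X` is a C⋆-algebra, being represented by adjointable operators
on `X ⊕ A`, and a decomposition `∑ ⟨x i, y i⟩ = 1`, which fullness provides, yields a quasi-basis of
index `1 + 1`. The two constructions are mutually inverse: the kernel of `E_X` is `X`, and `(a, x) ↦
a + x` is multiplicative from `B_{B₋}` to `B` since `B₋ B₋ ⊆ A`.

For the corner, `b ↦ e_A b` maps `B₋` onto `X_B`. The relation `b (1 - e_A) = e_A b` on `B₋`, again
a form of `B₋ B₋ ⊆ A`, matches the right inner products and the involutions. -/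

/-! ### Positive matrices over a C⋆-algebra -/

section Matrices

variable {A : Type u} [CStarAlgebra A] [PartialOrder A] [StarOrderedRing A]

/-- A sum of nonnegative elements which is nonpositive has vanishing terms. -/
theorem eq_zero_of_sum_star_mul_self_nonpos {n : ℕ} {c : Fin n → A}
    (h : ∑ k, star (c k) * c k ≤ 0) (k : Fin n) : c k = 0 := by
  have h0 : ∑ k, star (c k) * c k = 0 :=
    le_antisymm h (Finset.sum_nonneg fun k _ => star_mul_self_nonneg (c k))
  have := (Finset.sum_eq_zero_iff_of_nonneg fun k _ => star_mul_self_nonneg (c k)).mp h0 k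
    (Finset.mem_univ k)
  exact CStarRing.star_mul_self_eq_zero_iff _ |>.mp this

/-- The negative part `N` of a self-adjoint `H`: the element `N H N = -N ^ 3` is negative, and if it
vanishes, then `H` has the form `K⋆ K`. -/
theorem IsSelfAdjoint.exists_negPart {M : Type*} [CStarAlgebra M] {H : M} (hH : IsSelfAdjoint H) :
    ∃ N c : M, star N = N ∧ N * H * N = -(star c * c) ∧ (c = 0 → ∃ K, H = star K * K) := by
  let _ : PartialOrder M := CStarAlgebra.spectralOrder M
  have _ : StarOrderedRing M := CStarAlgebra.spectralOrderedRing M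
  have hN0 : 0 ≤ H⁻ := CFC.negPart_nonneg H
  have hNs : star H⁻ = H⁻ := IsSelfAdjoint.of_nonneg hN0
  -- The positive and negative parts of `H` are orthogonal, so only `-H⁻` survives in the middle.
  have h1 : H⁻ * H * H⁻ = -(H⁻ * H⁻ * H⁻) := by
    conv_lhs => enter [1, 2]; rw [← CFC.posPart_sub_negPart H hH]
    rw [mul_sub, CFC.negPart_mul_posPart, zero_sub, neg_mul]
  obtain ⟨c, hc⟩ := CStarAlgebra.nonneg_iff_eq_star_mul_self.mp
    (show 0 ≤ H⁻ * H⁻ * H⁻ by simpa [hNs] using star_left_conjugate_nonneg hN0 H⁻)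
  refine ⟨H⁻, c, hNs, by rw [h1, hc], fun hc0 => ?_⟩
  rw [← CStarAlgebra.nonneg_iff_eq_star_mul_self]
  have h3 : H⁻ * H⁻ * H⁻ = 0 := by rw [hc, hc0, mul_zero]
  have h4 : H⁻ * H⁻ = 0 := by
    rw [← CStarRing.star_mul_self_eq_zero_iff, star_mul, hNs, ← mul_assoc, h3, zero_mul]
  have h5 : H⁻ = 0 := by
    rw [← CStarRing.star_mul_self_eq_zero_iff, hNs, h4]
  rw [← CFC.posPart_sub_negPart H hH, h5, sub_zero]
  exact CFC.posPart_nonneg H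

/-- A hermitian matrix over a C⋆-algebra whose quadratic form is nonnegative has the form
`K⋆ K`. -/
theorem CStarMatrix.exists_eq_star_mul_self {n : ℕ} (H : CStarMatrix (Fin n) (Fin n) A)
    (hH : IsSelfAdjoint H) (hpos : ∀ x : Fin n → A, 0 ≤ ∑ i, ∑ j, star (x i) * H i j * x j) :
    ∃ K : CStarMatrix (Fin n) (Fin n) A, H = star K * K := by
  obtain ⟨N, c, hNs, h1, hK⟩ := hH.exists_negPart
  -- The `i`-th diagonal entry of `N H N` is the quadratic form at the `i`-th column of `N`, hence
  -- nonnegative; it is also minus the squared length of the `i`-th column of `c`. So that column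
  -- vanishes.
  refine hK <| CStarMatrix.ext fun k i =>
    eq_zero_of_sum_star_mul_self_nonpos (c := fun k => c k i) ?_ k
  have e1 : ∑ k, star (c k i) * c k i = (star c * c) i i := by
    rw [CStarMatrix.mul_apply]; rfl
  have e2 : (N * H * N) i i = ∑ j, ∑ k, star (N j i) * H j k * N k i := by
    rw [CStarMatrix.mul_apply, Finset.sum_comm]
    refine Finset.sum_congr rfl fun k _ => ?_
    rw [CStarMatrix.mul_apply, Finset.sum_mul]
    refine Finset.sum_congr rfl fun j _ => ?_
    rw [← CStarMatrix.star_apply, hNs]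
  have e3 := hpos fun k => N k i
  rw [← e2, h1, CStarMatrix.neg_apply, ← e1, neg_nonneg] at e3
  exact e3

theorem exists_eq_sum_star_mul {n : ℕ} (H : Fin n → Fin n → A)
    (hH : ∀ i j, star (H j i) = H i j)
    (hpos : ∀ x : Fin n → A, 0 ≤ ∑ i, ∑ j, star (x i) * H i j * x j) :
    ∃ K : Fin n → Fin n → A, ∀ i j, H i j = ∑ k, star (K k i) * K k j := by
  let M : CStarMatrix (Fin n) (Fin n) A := H
  obtain ⟨K, hK⟩ := M.exists_eq_star_mul_self (CStarMatrix.ext hH) hpos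
  refine ⟨K, fun i j => ?_⟩
  have := CStarMatrix.ext_iff.mpr hK i j
  rw [CStarMatrix.mul_apply] at this
  exact this

end Matrices

/-! ### Cauchy–Schwarz inequalities for rows -/

/-- If `∑ w k (w k)⋆ = 1`, then `x⋆ x ≤ ∑ (d k)⋆ d k` for `x = ∑ w k d k`. -/
theorem star_mul_self_le_of_sum_mul_star_eq_one {B : Type u} [CStarAlgebra B] [PartialOrder B]
    [StarOrderedRing B] {n : ℕ} (w d : Fin n → B) (hw : ∑ k, w k * star (w k) = 1) :
    star (∑ k, w k * d k) * (∑ k, w k * d k) ≤ ∑ k, star (d k) * d k := by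
  set x := ∑ k, w k * d k with hx
  have e1 : star x = ∑ k, star (d k) * star (w k) := by simp [hx]
  -- Completing the square: the defect in the inequality is itself a sum of squares.
  have key : ∑ k, star (d k - star (w k) * x) * (d k - star (w k) * x)
      = ∑ k, star (d k) * d k - star x * x := by
    have e : ∀ k, star (d k - star (w k) * x) * (d k - star (w k) * x)
        = star (d k) * d k - star (d k) * star (w k) * x - star x * (w k * d k)
          + star x * (w k * star (w k)) * x := by
      intro k
      simp only [star_sub, star_mul, star_star]
      noncomm_ring
    simp only [e, Finset.sum_add_distrib, Finset.sum_sub_distrib, ← Finset.sum_mul,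
      ← Finset.mul_sum, hw, ← hx, ← e1]
    noncomm_ring
  rw [← sub_nonneg, ← key]
  exact Finset.sum_nonneg fun k _ => star_mul_self_nonneg _

theorem sum_mul_sum_eq_sum_sum_mul {R : Type*} [Semiring R] {n : ℕ} (p q r : Fin n → Fin n → R)
    (u v : Fin n → R) (hr : ∀ i j, r i j = ∑ k, p i k * q k j) :
    ∑ k, (∑ i, u i * p i k) * (∑ j, q k j * v j) = ∑ i, ∑ j, u i * r i j * v j := by
  calc _ = ∑ k, ∑ i, ∑ j, u i * (p i k * q k j) * v j := by
        simp only [Finset.sum_mul_sum, mul_assoc]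
    _ = ∑ i, ∑ k, ∑ j, u i * (p i k * q k j) * v j := Finset.sum_comm
    _ = _ := Finset.sum_congr rfl fun i _ => by
        rw [Finset.sum_comm]
        simp only [hr, Finset.mul_sum, Finset.sum_mul]

/-- The Cauchy–Schwarz inequality for a row `u` of norm one with respect to a positive matrix. -/
theorem star_mul_self_le_of_row {A B : Type u} [CStarAlgebra A] [CStarAlgebra B] [PartialOrder B]
    [StarOrderedRing B] (ι : A →⋆ₐ[ℂ] B) {n : ℕ} (H K : Fin n → Fin n → A)
    (hHK : ∀ i j, H i j = ∑ k, star (K k i) * K k j) (u : Fin n → B)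
    (hu : ∑ i, ∑ j, u i * ι (H i j) * star (u j) = 1) (c : Fin n → A) {x : B}
    (hx : x = ∑ i, ∑ j, u i * ι (H i j) * ι (c j)) :
    star x * x ≤ ι (∑ i, ∑ j, star (c i) * H i j * c j) := by
  have hr : ∀ i j, ι (H i j) = ∑ k, ι (star (K k i)) * ι (K k j) := by
    intro i j; rw [hHK, map_sum]; simp only [map_mul]
  -- Factoring `H = K⋆K` reduces to the unweighted inequality with `w = u K⋆` and `d = K c`.
  have h1 : ∑ k, (∑ i, u i * ι (star (K k i))) * star (∑ i, u i * ι (star (K k i))) = 1 := by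
    rw [← hu, ← sum_mul_sum_eq_sum_sum_mul _ _ _ _ _ hr]
    simp only [star_sum, star_mul, map_star, star_star]
  have h2 : x = ∑ k, (∑ i, u i * ι (star (K k i))) * (∑ j, ι (K k j) * ι (c j)) := by
    rw [hx, ← sum_mul_sum_eq_sum_sum_mul _ _ _ _ _ hr]
  have h3 : ι (∑ i, ∑ j, star (c i) * H i j * c j)
      = ∑ k, star (∑ j, ι (K k j) * ι (c j)) * (∑ j, ι (K k j) * ι (c j)) := by
    simp only [map_sum, map_mul]
    rw [← sum_mul_sum_eq_sum_sum_mul _ _ _ _ _ hr]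
    simp only [star_sum, star_mul, map_star]
  rw [h3, h2]
  exact star_mul_self_le_of_sum_mul_star_eq_one _ _ h1

/-! ### Index two forces products of kernel elements into `A` -/

namespace IndexTwoExtension

variable {A : Type u} [CStarAlgebra A] (P : IndexTwoExtension A)

@[simp] theorem E_ι (a : A) : P.E (P.ι a) = a := P.condExp.apply_incl a

@[simp] theorem E_ι_mul (a : A) (b : P.B) : P.E (P.ι a * b) = a * P.E b := by
  simpa using P.condExp.bimodule a b 1

@[simp] theorem E_mul_ι (b : P.B) (a : A) : P.E (b * P.ι a) = P.E b * a := by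
  simpa using P.condExp.bimodule 1 b a

@[simp] theorem E_one : P.E 1 = 1 := by simpa using P.E_ι 1

theorem E_nonneg [PartialOrder A] [StarOrderedRing A] [PartialOrder P.B] [StarOrderedRing P.B]
    {b : P.B} (hb : 0 ≤ b) : 0 ≤ P.E b := by
  obtain ⟨d, rfl⟩ := CStarAlgebra.nonneg_iff_eq_star_mul_self.mp hb
  obtain ⟨c, hc⟩ := P.condExp.positive d
  rw [hc]
  exact star_mul_self_nonneg c

theorem E_star (b : P.B) : P.E (star b) = star (P.E b) := by
  let _ : PartialOrder A := CStarAlgebra.spectralOrder A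
  have _ : StarOrderedRing A := CStarAlgebra.spectralOrderedRing A
  let _ : PartialOrder P.B := CStarAlgebra.spectralOrder P.B
  have _ : StarOrderedRing P.B := CStarAlgebra.spectralOrderedRing P.B
  exact map_star (PositiveLinearMap.mk₀ P.E fun _ => P.E_nonneg) b

/-- The conditional expectation is faithful. -/
theorem eq_zero_of_E_star_mul_self {x : P.B} (h : P.E (star x * x) = 0) : x = 0 := by
  obtain ⟨n, u, v, hq, -⟩ := P.index_two
  obtain ⟨C, -, hC⟩ := moduleNorm_equivalent P.condExp hq
  have := (hC x).2
  rw [moduleNorm, h, norm_zero, Real.sqrt_zero, mul_zero] at this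
  exact norm_le_zero_iff.mp this

/-- A quasi-basis of the kernel of the conditional expectation, with index `1`. -/
theorem exists_kernel_quasiBasis : ∃ (n : ℕ) (u v : Fin n → P.B),
    (∀ i, P.E (u i) = 0) ∧ (∀ i, P.E (v i) = 0) ∧
    (∀ x, P.E x = 0 → ∑ i, u i * P.ι (P.E (v i * x)) = x) ∧
    (∀ x, P.E x = 0 → ∑ i, P.ι (P.E (x * u i)) * v i = x) ∧ ∑ i, u i * v i = 1 := by
  obtain ⟨n, u, v, ⟨h1, h2⟩, h3⟩ := P.index_two
  have a1 : ∑ i, u i * P.ι (P.E (v i)) = 1 := by simpa using h1 1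
  have a2 : ∑ i, P.ι (P.E (u i)) * v i = 1 := by simpa using h2 1
  have a3 : ∑ i, P.ι (P.E (u i)) * P.ι (P.E (v i)) = 1 := by
    have := congrArg (fun x => P.ι (P.E x)) a1
    simpa using this
  refine ⟨n, fun i => u i - P.ι (P.E (u i)), fun i => v i - P.ι (P.E (v i)), fun i => by simp,
    fun i => by simp, fun x hx => ?_, fun x hx => ?_, ?_⟩
  · have := congrArg (fun x => P.ι (P.E x)) (h1 x)
    simp only [map_sum, E_mul_ι, map_mul, hx, map_zero] at this
    simp [sub_mul, hx, Finset.sum_sub_distrib, h1, this]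
  · have := congrArg (fun x => P.ι (P.E x)) (h2 x)
    simp only [map_sum, E_ι_mul, map_mul, hx, map_zero] at this
    simp [mul_sub, hx, Finset.sum_sub_distrib, h2, this]
  -- The four terms of the product sum to `2 - 1 - 1 + 1`.
  · simp only [mul_sub, sub_mul, Finset.sum_sub_distrib, a1, a2, a3, h3]
    norm_num

/-- The product of two elements of the kernel of `E` lies in `A`. -/
theorem ι_E_mul {x y : P.B} (hx : P.E x = 0) (hy : P.E y = 0) : P.ι (P.E (x * y)) = x * y := by
  let _ : PartialOrder A := CStarAlgebra.spectralOrder A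
  have _ : StarOrderedRing A := CStarAlgebra.spectralOrderedRing A
  let _ : PartialOrder P.B := CStarAlgebra.spectralOrder P.B
  have _ : StarOrderedRing P.B := CStarAlgebra.spectralOrderedRing P.B
  obtain ⟨n, u, v, hu, hv, h1, h2, h3⟩ := P.exists_kernel_quasiBasis
  -- The Gram matrix of the `star (v j)` is positive: its quadratic form at `a` is `E (y⋆y)` with `y
  -- = ∑ star (v j) * a j`.
  obtain ⟨K, hHK⟩ := exists_eq_sum_star_mul (fun i j => P.E (v i * star (v j)))
    (fun i j => by simp [← E_star]) (fun a => by
      have : ∑ i, ∑ j, star (a i) * P.E (v i * star (v j)) * a j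
          = P.E (star (∑ j, star (v j) * P.ι (a j)) * ∑ j, star (v j) * P.ι (a j)) := by
        simp only [star_sum, Finset.sum_mul_sum, map_sum, star_mul, star_star, ← map_star]
        refine Finset.sum_congr rfl fun i _ => Finset.sum_congr rfl fun j _ => ?_
        rw [← P.E_ι_mul, ← P.E_mul_ι]
        simp only [mul_assoc]
      rw [this]
      exact P.E_nonneg (star_mul_self_nonneg _))
  -- the adjoint family is a quasi-basis as well
  have h1' : ∀ x, P.E x = 0 → ∑ j, star (v j) * P.ι (P.E (star (u j) * x)) = x := by
    intro x hx
    have := congrArg star (h2 (star x) (by rw [E_star, hx, star_zero]))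
    simpa [← map_star, ← E_star] using this
  have h2' : ∀ x, P.E x = 0 → ∑ j, P.ι (P.E (x * star (v j))) * star (u j) = x := by
    intro x hx
    have := congrArg star (h1 (star x) (by rw [E_star, hx, star_zero]))
    simpa [← map_star, ← E_star] using this
  have hsum : ∀ x, P.E x = 0 → ∀ i,
      ∑ j, P.E (v i * star (v j)) * P.E (star (u j) * x) = P.E (v i * x) := by
    intro x hx i
    conv_rhs => rw [← h1' x hx]
    simp [Finset.mul_sum, ← mul_assoc]
  have hle : ∀ x, P.E x = 0 → star x * x ≤ P.ι (P.E (star x * x)) := by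
    intro x hx
    have key := star_mul_self_le_of_row P.ι _ _ hHK u (x := x) ?_
      (fun j => P.E (star (u j) * x)) ?_
    · convert key using 2
      simp only [mul_assoc, ← Finset.mul_sum, hsum x hx]
      conv_lhs => enter [2, 2]; rw [← h1 x hx]
      simp only [Finset.mul_sum, map_sum, ← mul_assoc, E_mul_ι, ← E_star, star_mul, star_star]
    · simp only [mul_assoc, ← Finset.mul_sum, h2' _ (hv _), h3]
    · simp only [mul_assoc, ← Finset.mul_sum, ← map_mul, ← map_sum, hsum x hx, h1 x hx]
  have hstar : ∀ x, P.E x = 0 → P.ι (P.E (star x * x)) = star x * x := by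
    intro x hx
    -- The positive difference `c⋆c` satisfies `E (c⋆c) = 0`, so faithfulness kills it.
    obtain ⟨c, hc⟩ := CStarAlgebra.nonneg_iff_eq_star_mul_self.mp (sub_nonneg.mpr (hle x hx))
    have hc0 : c = 0 := P.eq_zero_of_E_star_mul_self (by rw [← hc]; simp)
    rw [hc0, mul_zero, sub_eq_zero] at hc
    exact hc
  -- Polarization with `z + w` and `z + i w` separates `z⋆w` from `w⋆z`.
  have hpol : ∀ z w, P.E z = 0 → P.E w = 0 → P.ι (P.E (star z * w)) = star z * w := by
    intro z w hz hw
    have d1 := hstar (z + w) (by simp [hz, hw])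
    have d2 := hstar (z + Complex.I • w) (by simp [hz, hw])
    simp only [star_add, star_smul, add_mul, mul_add, map_add, hstar z hz, hstar w hw,
      smul_mul_assoc, mul_smul_comm, map_smul, Complex.star_def, Complex.conj_I] at d1 d2
    have e1 : P.ι (P.E (star z * w)) + P.ι (P.E (star w * z)) = star z * w + star w * z := by
      rw [← sub_eq_zero] at d1 ⊢; rw [← d1]; abel
    have e2 : Complex.I • P.ι (P.E (star z * w)) - Complex.I • P.ι (P.E (star w * z))
        = Complex.I • (star z * w) - Complex.I • (star w * z) := by
      simp only [neg_smul] at d2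
      rw [← sub_eq_zero] at d2 ⊢; rw [← d2]; module
    rw [← smul_sub, ← smul_sub] at e2
    have e3 := smul_right_injective P.B Complex.I_ne_zero e2
    have e4 : (2 : ℂ) • P.ι (P.E (star z * w)) = (2 : ℂ) • (star z * w) := by
      simp only [two_smul]
      rw [← sub_eq_zero] at e1 e3 ⊢; rw [← add_zero (0 : P.B)]; nth_rw 1 [← e1]; rw [← e3]; abel
    exact smul_right_injective P.B two_ne_zero e4
  simpa using hpol (star x) y (by rw [E_star, hx, star_zero]) hy

end IndexTwoExtension

open MulOpposite

/-! ### Sesquilinearity and fullness of the inner products -/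

namespace EquivBimodule

variable {A : Type u} [CStarAlgebra A] (X : EquivBimodule A)

theorem linner_add_right (x y z : X.X) : X.linner x (y + z) = X.linner x y + X.linner x z := by
  rw [← X.star_linner, X.linner_add_left, star_add, X.star_linner, X.star_linner]

theorem rinner_add_left (x y z : X.X) : X.rinner (x + y) z = X.rinner x z + X.rinner y z := by
  rw [← X.star_rinner, X.rinner_add_right, star_add, X.star_rinner, X.star_rinner]

theorem linner_smul_right (a : A) (x y : X.X) :
    X.linner x (a • y) = X.linner x y * star a := by
  rw [← X.star_linner, X.linner_smul_left, star_mul, X.star_linner]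

theorem rinner_smul_left (x y : X.X) (a : A) :
    X.rinner (op a • x) y = star a * X.rinner x y := by
  rw [← X.star_rinner, X.rinner_smul_right, star_mul, X.star_rinner]

/-- Complex homogeneity follows from `A`-linearity, since `z` acts on `X` as the element `z • 1` of
`A`. -/
theorem linner_complex_smul_left (z : ℂ) (x y : X.X) :
    X.linner (z • x) y = z • X.linner x y := by
  rw [← one_smul A x, ← smul_assoc, X.linner_smul_left, smul_one_mul, one_smul]

theorem rinner_complex_smul_right (z : ℂ) (x y : X.X) :
    X.rinner x (z • y) = z • X.rinner x y := by
  rw [← one_smul Aᵐᵒᵖ y, ← smul_assoc, ← op_one, ← op_smul, X.rinner_smul_right, mul_smul_one,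
    op_one, one_smul]

theorem linner_complex_smul_right (z : ℂ) (x y : X.X) :
    X.linner x (z • y) = star z • X.linner x y := by
  rw [← X.star_linner, X.linner_complex_smul_left, star_smul, X.star_linner]

theorem linner_zero_right (x : X.X) : X.linner x 0 = 0 := by
  simpa using X.linner_add_right x 0 0

theorem linner_zero_left (x : X.X) : X.linner 0 x = 0 := by
  simpa using X.linner_add_left 0 0 x

theorem eq_zero_of_linner_self {x : X.X} (h : X.linner x x = 0) : x = 0 := by
  have := X.norm_sq_eq_linner x
  rw [h, norm_zero] at this
  exact norm_eq_zero.mp (pow_eq_zero_iff two_ne_zero |>.mp this)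

/-- By fullness, `1` is a finite sum of values of the left inner product. -/
theorem exists_sum_linner_eq_one :
    ∃ (n : ℕ) (x y : Fin n → X.X), ∑ i, X.linner (x i) (y i) = 1 := by
  have hsum : ∀ c ∈ Submodule.span ℂ {c : A | ∃ x y, X.linner x y = c},
      ∃ (n : ℕ) (x y : Fin n → X.X), ∑ i, X.linner (x i) (y i) = c := by
    intro c hc
    induction hc using Submodule.span_induction with
    | mem c hc =>
      obtain ⟨x, y, rfl⟩ := hc
      exact ⟨1, fun _ => x, fun _ => y, by simp⟩
    | zero => exact ⟨0, Fin.elim0, Fin.elim0, by simp⟩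
    | add c d _ _ hc hd =>
      obtain ⟨n, x, y, rfl⟩ := hc
      obtain ⟨m, x', y', rfl⟩ := hd
      exact ⟨n + m, Fin.append x x', Fin.append y y', by simp [Fin.sum_univ_add]⟩
    | smul z c _ hc =>
      obtain ⟨n, x, y, rfl⟩ := hc
      exact ⟨n, fun i => z • x i, y, by simp [linner_complex_smul_left, Finset.smul_sum]⟩
  -- The units form a nonempty open set, so the dense span contains one; its inverse is then
  -- absorbed into the left variable.
  obtain ⟨c, hc, hu⟩ := X.linner_full.exists_mem_open Units.isOpen ⟨1, isUnit_one⟩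
  obtain ⟨u, rfl⟩ := hu
  obtain ⟨n, x, y, h⟩ := hsum _ hc
  refine ⟨n, fun i => (↑u⁻¹ : A) • x i, y, ?_⟩
  simp only [X.linner_smul_left, ← Finset.mul_sum, h, Units.inv_mul]

end EquivBimodule

/-! ### The kernel `B₋` as an involutive equivalence bimodule -/

namespace IndexTwoExtension

variable {A : Type u} [CStarAlgebra A] (P : IndexTwoExtension A)

/-- Positive linear maps between C⋆-algebras are bounded. This makes `B₋` closed in `B`, hence
complete. -/
theorem continuous_E : Continuous P.E := by
  let _ : PartialOrder A := CStarAlgebra.spectralOrder A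
  have _ : StarOrderedRing A := CStarAlgebra.spectralOrderedRing A
  let _ : PartialOrder P.B := CStarAlgebra.spectralOrder P.B
  have _ : StarOrderedRing P.B := CStarAlgebra.spectralOrderedRing P.B
  obtain ⟨C, hC⟩ := (PositiveLinearMap.mk₀ P.E fun _ => P.E_nonneg).exists_norm_apply_le
  exact AddMonoidHomClass.continuous_of_bound P.E C hC

/-- The kernel `B₋` of the conditional expectation. -/
abbrev Kernel : Type u := LinearMap.ker P.E

namespace Kernel

variable {P}

theorem E_coe (x : P.Kernel) : P.E x = 0 := x.2

instance : CompleteSpace P.Kernel :=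
  (isClosed_singleton.preimage P.continuous_E : IsClosed {b | P.E b = 0}).completeSpace_coe

instance : SMul A P.Kernel := ⟨fun a x => ⟨P.ι a * x, by simp⟩⟩

instance : SMul Aᵐᵒᵖ P.Kernel := ⟨fun a x => ⟨x * P.ι a.unop, by simp⟩⟩

@[simp] theorem coe_smul (a : A) (x : P.Kernel) : ((a • x : P.Kernel) : P.B) = P.ι a * x := rfl

@[simp] theorem coe_op_smul (a : Aᵐᵒᵖ) (x : P.Kernel) :
    ((a • x : P.Kernel) : P.B) = x * P.ι a.unop := rfl

instance : Module A P.Kernel where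
  one_smul x := by ext; simp
  mul_smul a b x := by ext; simp [mul_assoc]
  smul_zero a := by ext; simp
  smul_add a x y := by ext; simp [mul_add]
  add_smul a b x := by ext; simp [add_mul]
  zero_smul x := by ext; simp

instance : Module Aᵐᵒᵖ P.Kernel where
  one_smul x := by ext; simp
  mul_smul a b x := by ext; simp [mul_assoc]
  smul_zero a := by ext; simp
  smul_add a x y := by ext; simp [add_mul]
  add_smul a b x := by ext; simp [mul_add]
  zero_smul x := by ext; simp

instance : SMulCommClass A Aᵐᵒᵖ P.Kernel := ⟨fun a b x => by ext; simp [mul_assoc]⟩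

instance : IsScalarTower ℂ A P.Kernel := ⟨fun z a x => by ext; simp⟩

instance : IsScalarTower ℂ Aᵐᵒᵖ P.Kernel := ⟨fun z a x => by ext; simp⟩

end Kernel

/-- `B₋` as an involutive equivalence bimodule. -/
noncomputable def kernelBimodule : InvolutiveBimodule A where
  X := P.Kernel
  linner x y := P.E (x * star (y : P.B))
  rinner x y := P.E (star (x : P.B) * y)
  linner_add_left x y z := by simp [add_mul]
  linner_smul_left a x y := by simp [mul_assoc]
  star_linner x y := by simp [← E_star]
  linner_self_nonneg x := by
    obtain ⟨c, hc⟩ := P.condExp.positive (star (x : P.B))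
    exact ⟨c, by rw [← hc, star_star]⟩
  norm_sq_eq_linner x := by
    -- Since `x x⋆` already lies in `A`, the inner product norm is the norm of `B`, by the
    -- C⋆-identity.
    rw [← NonUnitalStarAlgHom.norm_map P.ι P.ι_injective,
      P.ι_E_mul x.E_coe (by rw [E_star, x.E_coe, star_zero]), CStarRing.norm_self_mul_star, sq]
    rfl
  linner_full := by
    obtain ⟨n, u, v, hu, hv, -, -, h⟩ := P.exists_kernel_quasiBasis
    refine dense_iff_closure_eq.mpr (Set.eq_univ_of_forall fun a => subset_closure ?_)
    -- The relation `∑ u i * v i = 1` writes every `a` as a finite sum of inner products, so the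
    -- span is all of `A`.
    have ha : a = ∑ i, P.E (P.ι a * u i * v i) := by
      rw [← map_sum]; simp [mul_assoc, ← Finset.mul_sum, h]
    rw [ha]
    refine Submodule.sum_mem _ fun i _ => Submodule.subset_span
      ⟨a • ⟨u i, hu i⟩, ⟨star (v i), by rw [LinearMap.mem_ker, E_star, hv, star_zero]⟩, ?_⟩
    simp
  rinner_add_right x y z := by simp [mul_add]
  rinner_smul_right x y a := by simp [← mul_assoc]
  star_rinner x y := by simp [← E_star]
  rinner_self_nonneg x := P.condExp.positive x
  norm_sq_eq_rinner x := by
    rw [← NonUnitalStarAlgHom.norm_map P.ι P.ι_injective,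
      P.ι_E_mul (by rw [E_star, x.E_coe, star_zero]) x.E_coe, CStarRing.norm_star_mul_self, sq]
    rfl
  rinner_full := by
    obtain ⟨n, u, v, hu, hv, -, -, h⟩ := P.exists_kernel_quasiBasis
    refine dense_iff_closure_eq.mpr (Set.eq_univ_of_forall fun a => subset_closure ?_)
    have ha : a = ∑ i, P.E (u i * (v i * P.ι a)) := by
      rw [← map_sum]; simp [← mul_assoc, ← Finset.sum_mul, h]
    rw [ha]
    refine Submodule.sum_mem _ fun i _ => Submodule.subset_span
      ⟨⟨star (u i), by rw [LinearMap.mem_ker, E_star, hu, star_zero]⟩, op a • ⟨v i, hv i⟩, ?_⟩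
    simp
  linner_op_smul x y a := by simp [mul_assoc, map_star]
  rinner_smul a x y := by simp [mul_assoc, map_star]
  linner_smul_eq x y z := by
    ext
    simp only [Kernel.coe_smul, Kernel.coe_op_smul, unop_op]
    rw [P.ι_E_mul x.E_coe (by rw [E_star, y.E_coe, star_zero]),
      P.ι_E_mul (by rw [E_star, y.E_coe, star_zero]) z.E_coe, mul_assoc]
  sharp :=
    { toFun := fun x => ⟨star (x : P.B), by rw [LinearMap.mem_ker, E_star, x.E_coe, star_zero]⟩
      map_add' := fun x y => by ext; simp
      map_smul' := fun z x => by ext; simp }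
  sharp_sharp x := by ext; simp
  sharp_smul_smul a x b := by ext; simp [mul_assoc, map_star]
  linner_sharp x y := by simp

/-- The tautological isomorphism from `P.kernelBimodule` onto `B₋`. -/
noncomputable def kernelIso : P.KernelIso P.kernelBimodule where
  ρ := Submodule.subtype (LinearMap.ker P.E)
  injective := Subtype.val_injective
  range_eq := Subtype.range_val
  map_smul_left _ _ := rfl
  map_smul_right _ _ := rfl
  linner_eq _ _ := rfl
  rinner_eq _ _ := rfl
  map_sharp _ := rfl

/-! ### Uniqueness and transport of models of `B₋` -/

namespace KernelIso

variable {P} {X Y : InvolutiveBimodule A}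

theorem E_ρ (k : P.KernelIso X) (x : X.X) : P.E (k.ρ x) = 0 := by
  have : k.ρ x ∈ Set.range k.ρ := ⟨x, rfl⟩
  rwa [k.range_eq] at this

theorem exists_ρ_eq (k : P.KernelIso X) {b : P.B} (hb : P.E b = 0) : ∃ x, k.ρ x = b := by
  have : b ∈ Set.range k.ρ := by rwa [k.range_eq]
  exact this

/-- The underlying linear equivalence with the kernel of `E`. -/
noncomputable def linearEquiv (k : P.KernelIso X) : X.X ≃ₗ[ℂ] P.Kernel :=
  LinearEquiv.ofBijective (k.ρ.codRestrict _ k.E_ρ)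
    ⟨fun x y h => k.injective (congrArg Subtype.val h), fun b => by
      obtain ⟨x, hx⟩ := k.exists_ρ_eq b.2
      exact ⟨x, Subtype.ext hx⟩⟩

@[simp] theorem coe_linearEquiv (k : P.KernelIso X) (x : X.X) :
    (k.linearEquiv x : P.B) = k.ρ x := rfl

@[simp] theorem ρ_linearEquiv_symm (k : P.KernelIso X) (b : P.Kernel) :
    k.ρ (k.linearEquiv.symm b) = b := by
  rw [← coe_linearEquiv, LinearEquiv.apply_symm_apply]

/-- Two models of `B₋` are isomorphic. -/
theorem equiv (k : P.KernelIso X) (l : P.KernelIso Y) : X.Equiv Y := by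
  refine ⟨k.linearEquiv.trans l.linearEquiv.symm, fun a x => ?_, fun x a => ?_, fun x y => ?_,
    fun x y => ?_, fun x => ?_⟩
  · exact l.injective (by simp [l.map_smul_left, k.map_smul_left])
  · exact l.injective (by simp [l.map_smul_right, k.map_smul_right])
  · simp [l.linner_eq, k.linner_eq]
  · simp [l.rinner_eq, k.rinner_eq]
  · exact l.injective (by simp [l.map_sharp, k.map_sharp])

/-- Together with `equiv`, this shows that the models of `B₋` form exactly one isomorphism class. -/
theorem congr_right (k : P.KernelIso X) (h : X.Equiv Y) : Nonempty (P.KernelIso Y) := by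
  obtain ⟨σ, h1, h2, h3, h4, h5⟩ := InvolutiveBimodule.setoid A |>.symm h
  refine ⟨⟨k.ρ ∘ₗ σ.toLinearMap, k.injective.comp σ.injective, ?_, fun a x => ?_, fun x a => ?_,
    fun x y => ?_, fun x y => ?_, fun x => ?_⟩⟩
  · rw [← k.range_eq, LinearMap.coe_comp]
    exact σ.surjective.range_comp _
  · simp [h1, k.map_smul_left]
  · simp [h2, k.map_smul_right]
  · rw [← h3]; exact k.linner_eq _ _
  · rw [← h4]; exact k.rinner_eq _ _
  · simp [h5, k.map_sharp]

theorem congr_left {Q : IndexTwoExtension A} (k : P.KernelIso X) (h : P.Equiv Q) :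
    Nonempty (Q.KernelIso X) := by
  obtain ⟨π, h1, h2⟩ := h
  refine ⟨⟨(π : P.B →ₗ[ℂ] Q.B) ∘ₗ k.ρ, π.injective.comp k.injective, ?_, fun a x => ?_,
    fun x a => ?_, fun x y => ?_, fun x y => ?_, fun x => ?_⟩⟩
  · ext b
    constructor
    · rintro ⟨x, rfl⟩
      exact (h2 _).trans (k.E_ρ x)
    · intro hb
      obtain ⟨x, hx⟩ := k.exists_ρ_eq (b := π.symm b) (by
        rw [← h2, π.apply_symm_apply]; exact hb)
      exact ⟨x, (congrArg π hx).trans (π.apply_symm_apply b)⟩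
  · simp [k.map_smul_left, h1]
  · simp [k.map_smul_right, h1]
  · simp [k.linner_eq, ← h2, map_star]
  · simp [k.rinner_eq, ← h2, map_star]
  · simp [k.map_sharp, map_star]

end KernelIso

end IndexTwoExtension

/-! ### Norm estimates in an involutive bimodule -/

namespace InvolutiveBimodule

variable {A : Type u} [CStarAlgebra A] (X : InvolutiveBimodule A)

@[simp] theorem sharp_smul (a : A) (x : X.X) : X.sharp (a • x) = op (star a) • X.sharp x := by
  simpa using X.sharp_smul_smul a x 1

@[simp] theorem sharp_op_smul (a : A) (x : X.X) : X.sharp (op a • x) = star a • X.sharp x := by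
  simpa using X.sharp_smul_smul 1 x a

/-- The involution exchanges the two inner products, so estimates for the right structure follow
from those for the left one. -/
theorem linner_sharp_sharp (x y : X.X) : X.linner (X.sharp x) (X.sharp y) = X.rinner x y := by
  rw [X.linner_sharp, X.sharp_sharp]

@[simp] theorem norm_sharp (x : X.X) : ‖X.sharp x‖ = ‖x‖ := by
  rw [← sq_eq_sq₀ (norm_nonneg _) (norm_nonneg _), X.norm_sq_eq_linner, X.norm_sq_eq_rinner,
    linner_sharp_sharp]

theorem norm_smul_le (a : A) (x : X.X) : ‖a • x‖ ≤ ‖a‖ * ‖x‖ := by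
  refine (pow_le_pow_iff_left₀ (norm_nonneg _) (by positivity) two_ne_zero).mp ?_
  rw [X.norm_sq_eq_linner, X.linner_smul_left, X.linner_smul_right]
  calc _ ≤ ‖a‖ * (‖X.linner x x‖ * ‖star a‖) :=
        (norm_mul_le _ _).trans (by gcongr; exact norm_mul_le _ _)
    _ = _ := by rw [← X.norm_sq_eq_linner, norm_star]; ring

theorem norm_op_smul_le (x : X.X) (a : A) : ‖op a • x‖ ≤ ‖a‖ * ‖x‖ := by
  rw [← X.norm_sharp, sharp_op_smul, ← norm_star a, ← X.norm_sharp x]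
  exact X.norm_smul_le _ _

/-! ### The Hilbert module `X ⊕ A` -/

/-- A bimodule as a Hilbert module for its left inner product. -/
noncomputable abbrev leftCStarModule [PartialOrder A] [StarOrderedRing A] : CStarModule A X.X where
  inner x y := X.linner y x
  inner_add_right := X.linner_add_left _ _ _
  inner_self_nonneg {x} := by
    obtain ⟨c, hc⟩ := X.linner_self_nonneg x
    rw [hc]
    exact star_mul_self_nonneg c
  inner_self := ⟨X.eq_zero_of_linner_self, by rintro rfl; exact X.linner_zero_left 0⟩
  inner_op_smul_right := X.linner_smul_left _ _ _
  inner_smul_right_complex := X.linner_complex_smul_left _ _ _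
  star_inner x y := X.star_linner _ _
  norm_eq_sqrt_norm_inner_self x := by rw [← X.norm_sq_eq_linner, Real.sqrt_sq (norm_nonneg x)]

/-- The right Hilbert module `X ⊕ A`. -/
def HilbertSum : Type u := X.X × A

namespace HilbertSum

variable {X}

noncomputable instance : AddCommGroup X.HilbertSum := inferInstanceAs (AddCommGroup (X.X × A))

noncomputable instance : Module ℂ X.HilbertSum := inferInstanceAs (Module ℂ (X.X × A))

/-- The norm of the Hilbert module. -/
noncomputable def hnorm (v : X.HilbertSum) : ℝ := LinkingAlgebra.sumNorm (X := X.toEquivBimodule) v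

/-- The inner product of the Hilbert module. -/
noncomputable def form (v w : X.HilbertSum) : A := X.rinner v.1 w.1 + star v.2 * w.2

theorem hnorm_eq (v : X.HilbertSum) : hnorm v = √‖form v v‖ := rfl

/-- The conjugate linear map `(x, a) ↦ (x♯, a⋆)` turns the right module `X ⊕ A` into a direct sum of
left Hilbert modules, where Cauchy–Schwarz and the triangle inequality are available. -/
theorem hnorm_properties (v w : X.HilbertSum) :
    hnorm (v + w) ≤ hnorm v + hnorm w ∧ ‖form v w‖ ≤ hnorm v * hnorm w ∧
    ‖v.1‖ ≤ hnorm v ∧ ‖v.2‖ ≤ hnorm v ∧ hnorm v ≤ ‖v.1‖ + ‖v.2‖ := by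
  let _ : PartialOrder A := CStarAlgebra.spectralOrder A
  have _ : StarOrderedRing A := CStarAlgebra.spectralOrderedRing A
  let _ := X.leftCStarModule
  let J : X.HilbertSum → WithCStarModule A (X.X × A) := fun v =>
    (WithCStarModule.equiv A (X.X × A)).symm (X.sharp v.1, star v.2)
  have hJ : ∀ v w, inner A (J v) (J w) = form w v := by
    intro v w
    rw [WithCStarModule.prod_inner]
    change X.linner (X.sharp w.1) (X.sharp v.1) + star w.2 * star (star v.2) = _
    rw [X.linner_sharp_sharp, star_star, form]
  have hn : ∀ v, hnorm v = ‖J v‖ := by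
    intro v
    rw [hnorm_eq, ← hJ]
    exact (CStarModule.norm_eq_sqrt_norm_inner_self _).symm
  have hadd : J (v + w) = J v + J w := by
    apply (WithCStarModule.equiv A (X.X × A)).injective
    exact Prod.ext (map_add X.sharp _ _) (star_add _ _)
  have hmax := WithCStarModule.max_le_prod_norm (J v)
  have hle := WithCStarModule.prod_norm_le_norm_add (J v)
  have e1 : ‖(J v).1‖ = ‖v.1‖ := X.norm_sharp _
  have e2 : ‖(J v).2‖ = ‖v.2‖ := norm_star _
  rw [e1, e2] at hmax hle
  refine ⟨?_, ?_, ?_, ?_, ?_⟩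
  · rw [hn, hn, hn, hadd]; exact norm_add_le _ _
  · rw [← hJ, hn, hn, mul_comm]; exact CStarModule.norm_inner_le _
  · rw [hn]; exact (le_max_left _ _).trans hmax
  · rw [hn]; exact (le_max_right _ _).trans hmax
  · rw [hn]; exact hle

theorem form_smul_smul (z : ℂ) (v : X.HilbertSum) :
    form (z • v) (z • v) = (star z * z) • form v v := by
  change X.rinner (z • v.1) (z • v.1) + star (z • v.2) * (z • v.2) = _
  rw [X.rinner_complex_smul_right, ← X.star_rinner, X.rinner_complex_smul_right, star_smul,
    X.star_rinner, star_smul, smul_mul_smul_comm, smul_smul, form, smul_add, mul_comm]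

noncomputable instance : Norm X.HilbertSum := ⟨hnorm⟩

theorem normedSpaceCore : NormedSpace.Core ℂ X.HilbertSum where
  norm_nonneg v := Real.sqrt_nonneg _
  norm_smul z v := by
    change hnorm _ = _ * hnorm _
    rw [hnorm_eq, hnorm_eq, form_smul_smul, norm_smul, Real.sqrt_mul (norm_nonneg _),
      CStarRing.norm_star_mul_self, Real.sqrt_mul_self (norm_nonneg _)]
  norm_triangle v w := (hnorm_properties v w).1
  norm_eq_zero_iff v := by
    constructor
    · intro h
      obtain ⟨-, -, h1, h2, -⟩ := hnorm_properties v v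
      have h : hnorm v = 0 := h
      rw [h] at h1 h2
      exact Prod.ext (norm_le_zero_iff.mp h1) (norm_le_zero_iff.mp h2)
    · rintro rfl
      have := (hnorm_properties (0 : X.HilbertSum) 0).2.2.2.2
      refine le_antisymm (this.trans ?_) (Real.sqrt_nonneg _)
      change ‖(0 : X.X)‖ + ‖(0 : A)‖ ≤ 0
      simp

noncomputable instance : NormedAddCommGroup X.HilbertSum := .ofCore normedSpaceCore

noncomputable instance : NormedSpace ℂ X.HilbertSum := .ofCore normedSpaceCore

theorem norm_add_le_fst_snd (v : X.HilbertSum) : ‖v‖ ≤ ‖v.1‖ + ‖v.2‖ :=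
  (hnorm_properties v v).2.2.2.2

theorem norm_fst_le (v : X.HilbertSum) : ‖v.1‖ ≤ ‖v‖ := (hnorm_properties v v).2.2.1

theorem norm_snd_le (v : X.HilbertSum) : ‖v.2‖ ≤ ‖v‖ := (hnorm_properties v v).2.2.2.1

theorem norm_form_le (v w : X.HilbertSum) : ‖form v w‖ ≤ ‖v‖ * ‖w‖ := (hnorm_properties v w).2.1

theorem norm_sq_eq (v : X.HilbertSum) : ‖v‖ ^ 2 = ‖form v v‖ :=
  Real.sq_sqrt (norm_nonneg _)

theorem norm_rinner_le (x y : X.X) : ‖X.rinner x y‖ ≤ ‖x‖ * ‖y‖ := by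
  have h := norm_form_le (X := X) (x, 0) (y, 0)
  have h1 := norm_add_le_fst_snd (X := X) (x, 0)
  have h2 := norm_add_le_fst_snd (X := X) (y, 0)
  simp only [form, mul_zero, add_zero, norm_zero] at h h1 h2
  exact h.trans (mul_le_mul h1 h2 (norm_nonneg _) (norm_nonneg _))

end HilbertSum

/-! ### The algebra of an involutive bimodule -/

/-- The algebra `B_X`, with `(a, x)` for the matrix `[[a, x], [(x♯)~, a]]`. -/
def Ext : Type u := A × X.X

namespace Ext

variable {X}

@[ext] theorem ext {m n : X.Ext} (h1 : m.1 = n.1) (h2 : m.2 = n.2) : m = n := Prod.ext h1 h2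

noncomputable instance : AddCommGroup X.Ext := inferInstanceAs (AddCommGroup (A × X.X))

noncomputable instance : Module ℂ X.Ext := inferInstanceAs (Module ℂ (A × X.X))

/-- The first row of the matrix product; it determines the second row through `♯`. -/
instance : Mul X.Ext :=
  ⟨fun m n => (m.1 * n.1 + X.linner m.2 (X.sharp n.2), m.1 • n.2 + op n.1 • m.2)⟩

instance : One X.Ext := ⟨(1, 0)⟩

instance : Star X.Ext := ⟨fun m => (star m.1, X.sharp m.2)⟩

@[simp] theorem fst_add (m n : X.Ext) : (m + n).1 = m.1 + n.1 := rfl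
@[simp] theorem snd_add (m n : X.Ext) : (m + n).2 = m.2 + n.2 := rfl
@[simp] theorem fst_zero : (0 : X.Ext).1 = 0 := rfl
@[simp] theorem snd_zero : (0 : X.Ext).2 = 0 := rfl
@[simp] theorem fst_one : (1 : X.Ext).1 = 1 := rfl
@[simp] theorem snd_one : (1 : X.Ext).2 = 0 := rfl
@[simp] theorem fst_smul (z : ℂ) (m : X.Ext) : (z • m).1 = z • m.1 := rfl
@[simp] theorem snd_smul (z : ℂ) (m : X.Ext) : (z • m).2 = z • m.2 := rfl
@[simp] theorem fst_mul (m n : X.Ext) :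
    (m * n).1 = m.1 * n.1 + X.linner m.2 (X.sharp n.2) := rfl
@[simp] theorem snd_mul (m n : X.Ext) : (m * n).2 = m.1 • n.2 + op n.1 • m.2 := rfl
@[simp] theorem fst_star (m : X.Ext) : (star m).1 = star m.1 := rfl
@[simp] theorem snd_star (m : X.Ext) : (star m).2 = X.sharp m.2 := rfl

theorem linner_sharp_mul (x y : X.X) (c : A) :
    X.linner x (X.sharp y) * c = X.linner x (X.sharp (op c • y)) := by
  rw [sharp_op_smul, X.linner_smul_right, star_star]

theorem linner_op_smul_sharp (x y : X.X) (b : A) :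
    X.linner (op b • x) (X.sharp y) = X.linner x (X.sharp (b • y)) := by
  rw [sharp_smul, X.linner_op_smul]

/-- Associativity for three off-diagonal factors: the compatibility of the two inner products,
rewritten through `♯`. -/
theorem linner_sharp_smul (x y z : X.X) :
    X.linner x (X.sharp y) • z = op (X.linner y (X.sharp z)) • x := by
  rw [X.linner_smul_eq, X.linner_sharp y]

noncomputable instance : Ring X.Ext where
  __ := (inferInstance : AddCommGroup X.Ext)
  left_distrib a b c := by
    ext
    · simp only [fst_mul, fst_add, snd_add, mul_add, map_add, X.linner_add_right]; abel
    · simp only [snd_mul, fst_add, snd_add, smul_add, op_add, add_smul]; abel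
  right_distrib a b c := by
    ext
    · simp only [fst_mul, fst_add, snd_add, add_mul, X.linner_add_left]; abel
    · simp only [snd_mul, fst_add, snd_add, smul_add, add_smul]; abel
  zero_mul a := by ext <;> simp [X.linner_zero_left]
  mul_zero a := by ext <;> simp [X.linner_zero_right]
  mul_assoc a b c := by
    ext
    · simp only [fst_mul, snd_mul, add_mul, mul_add, map_add, X.linner_add_left,
        X.linner_add_right, mul_assoc, linner_sharp_mul, X.linner_smul_left, linner_op_smul_sharp]
      abel
    · simp only [fst_mul, snd_mul, add_smul, smul_add, op_add, linner_sharp_smul, mul_smul,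
        op_mul, smul_comm (_ : A) (_ : Aᵐᵒᵖ)]
      abel
  one_mul a := by ext <;> simp [X.linner_zero_left]
  mul_one a := by ext <;> simp [X.linner_zero_right]
  neg_add_cancel := neg_add_cancel
  zsmul := fun n x => n • x

instance : StarRing X.Ext where
  star_involutive m := by ext <;> simp [X.sharp_sharp]
  star_add m n := by ext <;> simp
  star_mul m n := by
    ext
    · simp only [fst_star, fst_mul, snd_star, star_add, star_mul, X.star_linner, X.sharp_sharp]
    · simp [add_comm]

instance : StarModule ℂ X.Ext := ⟨fun z m => by ext <;> simp⟩

noncomputable instance : Algebra ℂ X.Ext := Algebra.ofModule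
  (fun z m n => by
    ext
    · simp [X.linner_complex_smul_left, smul_add]
    · simp only [snd_mul, snd_smul, fst_smul, smul_add, smul_assoc]
      rw [smul_comm z (op n.1)])
  (fun z m n => by
    ext
    · simp [X.linner_complex_smul_right, smul_add]
    · simp only [snd_mul, snd_smul, fst_smul, smul_add, op_smul, smul_assoc]
      rw [smul_comm z m.1])

/-- The action of `B_X` on the Hilbert module `X ⊕ A`. -/
noncomputable def actₗ (m : X.Ext) : X.HilbertSum →ₗ[ℂ] X.HilbertSum where
  toFun v := (m.1 • v.1 + op v.2 • m.2, X.rinner (X.sharp m.2) v.1 + m.1 * v.2)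
  map_add' v w := by
    refine Prod.ext ?_ ?_
    · change m.1 • (v.1 + w.1) + op (v.2 + w.2) • m.2 = _ + _ + (_ + _)
      rw [smul_add, op_add, add_smul]; abel
    · change X.rinner (X.sharp m.2) (v.1 + w.1) + m.1 * (v.2 + w.2) = _ + _ + (_ + _)
      rw [X.rinner_add_right, mul_add]; abel
  map_smul' z v := by
    refine Prod.ext ?_ ?_
    · change m.1 • z • v.1 + op (z • v.2) • m.2 = z • (_ + _)
      rw [smul_add, op_smul, smul_assoc, smul_comm z m.1]
    · change X.rinner (X.sharp m.2) (z • v.1) + m.1 * (z • v.2) = z • (_ + _)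
      rw [smul_add, X.rinner_complex_smul_right, mul_smul_comm]

theorem actₗ_fst (m : X.Ext) (v : X.HilbertSum) :
    (actₗ m v).1 = m.1 • v.1 + op v.2 • m.2 := rfl

theorem actₗ_snd (m : X.Ext) (v : X.HilbertSum) :
    (actₗ m v).2 = X.linner m.2 (X.sharp v.1) + m.1 * v.2 := by
  rw [X.linner_sharp]; rfl

theorem norm_actₗ_le (m : X.Ext) (v : X.HilbertSum) :
    ‖actₗ m v‖ ≤ (2 * (‖m.1‖ + ‖m.2‖)) * ‖v‖ := by
  have h1 : ‖m.1 • v.1 + op v.2 • m.2‖ ≤ ‖m.1‖ * ‖v‖ + ‖m.2‖ * ‖v‖ := by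
    refine norm_add_le_of_le ((X.norm_smul_le _ _).trans ?_) ((X.norm_op_smul_le _ _).trans ?_)
    · gcongr; exact HilbertSum.norm_fst_le v
    · rw [mul_comm]; gcongr; exact HilbertSum.norm_snd_le v
  have h2 : ‖X.rinner (X.sharp m.2) v.1 + m.1 * v.2‖ ≤ ‖m.2‖ * ‖v‖ + ‖m.1‖ * ‖v‖ := by
    refine norm_add_le_of_le ((HilbertSum.norm_rinner_le _ _).trans ?_) ((norm_mul_le _ _).trans ?_)
    · rw [X.norm_sharp]; gcongr; exact HilbertSum.norm_fst_le v
    · gcongr; exact HilbertSum.norm_snd_le v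
  refine (HilbertSum.norm_add_le_fst_snd _).trans ((add_le_add h1 h2).trans_eq ?_)
  ring

theorem actₗ_mul (m n : X.Ext) (v : X.HilbertSum) : actₗ (m * n) v = actₗ m (actₗ n v) := by
  refine Prod.ext ?_ ?_
  · simp only [actₗ_fst, actₗ_snd, fst_mul, snd_mul, add_smul, smul_add, op_add,
      linner_sharp_smul, mul_smul, op_mul, smul_comm (_ : A) (_ : Aᵐᵒᵖ)]
    abel
  · simp only [actₗ_fst, actₗ_snd, fst_mul, snd_mul, add_mul, mul_add, map_add, X.linner_add_left,
      X.linner_add_right, mul_assoc, linner_sharp_mul, X.linner_smul_left, linner_op_smul_sharp]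
    abel

theorem actₗ_add (m n : X.Ext) (v : X.HilbertSum) : actₗ (m + n) v = actₗ m v + actₗ n v := by
  refine Prod.ext ?_ ?_
  · change _ = (actₗ m v).1 + (actₗ n v).1
    simp only [actₗ_fst, fst_add, snd_add, add_smul, smul_add]; abel
  · change _ = (actₗ m v).2 + (actₗ n v).2
    simp only [actₗ_snd, fst_add, snd_add, X.linner_add_left, add_mul]; abel

theorem actₗ_smul (z : ℂ) (m : X.Ext) (v : X.HilbertSum) : actₗ (z • m) v = z • actₗ m v := by
  refine Prod.ext ?_ ?_
  · change _ = z • (actₗ m v).1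
    rw [actₗ_fst, actₗ_fst, fst_smul, snd_smul, smul_add, smul_assoc, smul_comm z (op v.2)]
  · change _ = z • (actₗ m v).2
    simp only [actₗ_snd, fst_smul, snd_smul, X.linner_complex_smul_left, smul_add, smul_mul_assoc]

theorem actₗ_one (v : X.HilbertSum) : actₗ 1 v = v := by
  refine Prod.ext ?_ ?_
  · simp [actₗ_fst]
  · simp [actₗ_snd, X.linner_zero_left]

/-- `B_X` acts by adjointable operators, and its star is the adjoint; the C⋆-identity rests on this.
-/
theorem form_actₗ (m : X.Ext) (v w : X.HilbertSum) :
    HilbertSum.form (actₗ m v) w = HilbertSum.form v (actₗ (star m) w) := by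
  simp only [HilbertSum.form, actₗ_fst, actₗ_snd, fst_star, snd_star, X.rinner_add_left,
    X.rinner_add_right, X.rinner_smul, X.rinner_smul_left, X.rinner_smul_right, star_add,
    X.star_linner, star_mul, add_mul, mul_add, X.linner_sharp_sharp, mul_assoc]
  have h : X.linner (X.sharp v.1) m.2 = X.rinner v.1 (X.sharp m.2) := by
    rw [← X.linner_sharp_sharp, X.sharp_sharp]
  rw [h]
  abel

/-- The vector `(0, 1)` of `X ⊕ A` is cyclic and separating for `B_X`. -/
def vac : X.HilbertSum := ((0 : X.X), (1 : A))

theorem actₗ_vac (m : X.Ext) : actₗ m vac = (m.2, m.1) := by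
  refine Prod.ext ?_ ?_
  · rw [actₗ_fst]; simp [vac]
  · rw [actₗ_snd]; simp [vac, X.linner_zero_right]

theorem norm_vac_le : ‖(vac : X.HilbertSum)‖ ≤ 1 := by
  refine (HilbertSum.norm_add_le_fst_snd _).trans ?_
  -- In the zero algebra `1 = 0` has norm `0`, whence only an inequality.
  rcases subsingleton_or_nontrivial A with h | h
  · simp [vac, Subsingleton.elim (1 : A) 0]
  · simp [vac]

/-- The representation of `B_X` on the Hilbert module `X ⊕ A`. -/
noncomputable def repr : X.Ext →ₐ[ℂ] (X.HilbertSum →L[ℂ] X.HilbertSum) :=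
  AlgHom.ofLinearMap
    { toFun := fun m => (actₗ m).mkContinuous _ (norm_actₗ_le m)
      map_add' := fun m n => by ext1 v; exact actₗ_add m n v
      map_smul' := fun z m => by ext1 v; exact actₗ_smul z m v }
    (by ext1 v; exact actₗ_one v) (fun m n => by ext1 v; exact actₗ_mul m n v)

theorem repr_apply (m : X.Ext) (v : X.HilbertSum) : repr m v = actₗ m v := rfl

theorem repr_injective : Function.Injective (repr : X.Ext → _) := by
  intro m n h
  have : actₗ m vac = actₗ n vac := congrArg (fun T => T vac) h
  rw [actₗ_vac, actₗ_vac] at this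
  exact Ext.ext (congrArg Prod.snd this) (congrArg Prod.fst this)

noncomputable instance : NormedRing X.Ext :=
  NormedRing.induced X.Ext _ (repr : X.Ext →ₐ[ℂ] _) repr_injective

noncomputable instance : NormedAlgebra ℂ X.Ext :=
  NormedAlgebra.induced ℂ X.Ext _ (repr : X.Ext →ₐ[ℂ] _)

theorem norm_actₗ_le_norm (m : X.Ext) (v : X.HilbertSum) : ‖actₗ m v‖ ≤ ‖m‖ * ‖v‖ :=
  (repr m).le_opNorm v

/-- The usual Hilbert module argument: `‖m v‖² = ‖⟨v, m⋆m v⟩‖ ≤ ‖m⋆m‖ ‖v‖²`. -/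
instance : CStarRing X.Ext where
  norm_mul_self_le m := by
    have h : ‖m‖ ≤ √‖star m * m‖ := by
      refine ContinuousLinearMap.opNorm_le_bound _ (Real.sqrt_nonneg _) fun v => ?_
      refine (pow_le_pow_iff_left₀ (norm_nonneg _) (by positivity) two_ne_zero).mp ?_
      rw [repr_apply, HilbertSum.norm_sq_eq, form_actₗ, ← actₗ_mul, mul_pow,
        Real.sq_sqrt (norm_nonneg _)]
      calc _ ≤ ‖v‖ * (‖star m * m‖ * ‖v‖) :=
            (HilbertSum.norm_form_le _ _).trans (by gcongr; exact norm_actₗ_le_norm _ _)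
        _ = _ := by ring
    calc ‖m‖ * ‖m‖ ≤ √‖star m * m‖ * √‖star m * m‖ := by gcongr
      _ = _ := Real.mul_self_sqrt (norm_nonneg _)

theorem norm_le (m : X.Ext) : ‖m‖ ≤ 2 * (‖m.1‖ + ‖m.2‖) :=
  (actₗ m).mkContinuous_norm_le (by positivity) (norm_actₗ_le m)

theorem norm_actₗ_vac_le (m : X.Ext) : ‖actₗ m vac‖ ≤ ‖m‖ :=
  (norm_actₗ_le_norm m vac).trans (mul_le_of_le_one_right (norm_nonneg _) norm_vac_le)

theorem norm_fst_le (m : X.Ext) : ‖m.1‖ ≤ ‖m‖ := by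
  refine le_trans ?_ (norm_actₗ_vac_le m)
  rw [actₗ_vac]
  exact HilbertSum.norm_snd_le (X := X) (m.2, m.1)

theorem norm_snd_le (m : X.Ext) : ‖m.2‖ ≤ ‖m‖ := by
  refine le_trans ?_ (norm_actₗ_vac_le m)
  rw [actₗ_vac]
  exact HilbertSum.norm_fst_le (X := X) (m.2, m.1)

/-- The operator norm is equivalent to the product norm, so completeness passes from `A × X` to
`B_X`. The bound `1` comes from evaluation at `vac`, the bound `4` from `2 (‖a‖ + ‖x‖) ≤ 4 max ‖a‖
‖x‖`. -/
noncomputable def equivProd : X.Ext ≃L[ℂ] A × X.X :=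
  LinearEquiv.toContinuousLinearEquivOfBounds
    { toFun := fun m => (m.1, m.2)
      invFun := fun p => p
      map_add' := fun _ _ => rfl
      map_smul' := fun _ _ => rfl
      left_inv := fun _ => rfl
      right_inv := fun _ => rfl } 1 4
    (fun m => by
      rw [one_mul]
      exact max_le (norm_fst_le m) (norm_snd_le m))
    (fun p => (norm_le _).trans (by
      have h1 : ‖p.1‖ ≤ ‖p‖ := _root_.norm_fst_le p
      have h2 : ‖p.2‖ ≤ ‖p‖ := _root_.norm_snd_le p
      change 2 * (‖p.1‖ + ‖p.2‖) ≤ _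
      linarith))

instance : CompleteSpace X.Ext := by
  have h := ContinuousLinearEquiv.isUniformEmbedding (equivProd (X := X))
  exact (completeSpace_congr (e := equivProd.toEquiv) h).mpr inferInstance

noncomputable instance : CStarAlgebra X.Ext where

/-- The matrix in the linking algebra. -/
def toLinking (m : X.Ext) : LinkingAlgebra X.toEquivBimodule := ⟨m.1, m.2, X.sharp m.2, m.1⟩

theorem isNorm_toLinking (m : X.Ext) : (toLinking m).IsNorm ‖m‖ := (repr m).isLeast_opNorm

theorem toLinking_add (m n : X.Ext) : toLinking (m + n) = toLinking m + toLinking n :=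
  LinkingAlgebra.ext rfl rfl (map_add X.sharp _ _) rfl

theorem toLinking_smul (z : ℂ) (m : X.Ext) : toLinking (z • m) = z • toLinking m :=
  LinkingAlgebra.ext rfl rfl (map_smulₛₗ X.sharp _ _) rfl

theorem toLinking_mul (m n : X.Ext) : toLinking (m * n) = toLinking m * toLinking n := by
  refine LinkingAlgebra.ext rfl rfl ?_ ?_
  · change X.sharp (m.1 • n.2 + op n.1 • m.2) = star n.1 • X.sharp m.2 + op (star m.1) • X.sharp n.2
    simp [add_comm]
  · change m.1 * n.1 + X.linner m.2 (X.sharp n.2) = X.rinner (X.sharp m.2) n.2 + m.1 * n.1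
    rw [X.linner_sharp, add_comm]

theorem toLinking_star (m : X.Ext) : toLinking (star m) = star (toLinking m) :=
  LinkingAlgebra.ext rfl rfl (X.sharp_sharp _) rfl

theorem toLinking_injective : Function.Injective (toLinking : X.Ext → _) := fun _ _ h =>
  Ext.ext (congrArg LinkingAlgebra.a h) (congrArg LinkingAlgebra.x h)

/-- The inclusion of `A` in `B_X`. -/
noncomputable def incl : A →⋆ₐ[ℂ] X.Ext where
  toFun a := (a, 0)
  map_one' := rfl
  map_mul' a b := by
    refine Ext.ext ?_ ?_
    · change a * b = a * b + X.linner 0 (X.sharp 0)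
      rw [X.linner_zero_left, add_zero]
    · change (0 : X.X) = a • 0 + op b • 0
      simp
  map_zero' := rfl
  map_add' a b := Ext.ext rfl (add_zero (0 : X.X)).symm
  commutes' z := by
    rw [Algebra.algebraMap_eq_smul_one, Algebra.algebraMap_eq_smul_one]
    refine Ext.ext rfl ?_
    simp
  map_star' a := Ext.ext rfl (map_zero X.sharp).symm

@[simp] theorem fst_incl (a : A) : (incl a : X.Ext).1 = a := rfl
@[simp] theorem snd_incl (a : A) : (incl a : X.Ext).2 = 0 := rfl

/-- The conditional expectation of `B_X` onto `A`. -/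
noncomputable def expect : X.Ext →ₗ[ℂ] A where
  toFun m := m.1
  map_add' _ _ := rfl
  map_smul' _ _ := rfl

theorem expect_apply (m : X.Ext) : expect m = m.1 := rfl

theorem isConditionalExpectation : IsConditionalExpectation (incl : A →⋆ₐ[ℂ] X.Ext) expect where
  apply_incl _ := rfl
  bimodule a m b := by
    simp [expect_apply, X.linner_zero_left, X.linner_zero_right]
  positive m := by
    let _ : PartialOrder A := CStarAlgebra.spectralOrder A
    have _ : StarOrderedRing A := CStarAlgebra.spectralOrderedRing A
    obtain ⟨c, hc⟩ := X.linner_self_nonneg (X.sharp m.2)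
    -- For `m = (a, x)` the value is `a⋆a + ⟨x♯, x♯⟩`, a sum of two positive elements.
    have : 0 ≤ expect (star m * m) := by
      rw [expect_apply, fst_mul, fst_star, snd_star, hc]
      exact add_nonneg (star_mul_self_nonneg _) (star_mul_self_nonneg _)
    exact CStarAlgebra.nonneg_iff_eq_star_mul_self.mp this

theorem snd_sum {n : ℕ} (f : Fin n → X.Ext) : (∑ i, f i).2 = ∑ i, (f i).2 :=
  map_sum (AddMonoidHom.mk' (fun m : X.Ext => m.2) fun _ _ => rfl) f _

theorem fst_sum {n : ℕ} (f : Fin n → X.Ext) : (∑ i, f i).1 = ∑ i, (f i).1 :=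
  map_sum expect f _

/-- The element `x` of `X` as an element of `B_X`. -/
def off (x : X.X) : X.Ext := ((0 : A), x)

@[simp] theorem fst_off (x : X.X) : (off x).1 = 0 := rfl
@[simp] theorem snd_off (x : X.X) : (off x).2 = x := rfl

theorem off_smul (a : A) (x : X.X) : off (a • x) = incl a * off x := by
  refine Ext.ext ?_ ?_ <;> simp [X.linner_zero_left]

theorem off_op_smul (x : X.X) (a : A) : off (op a • x) = off x * incl a := by
  refine Ext.ext ?_ ?_ <;> simp [X.linner_zero_right]

theorem toLinking_incl (a : A) : toLinking (incl a : X.Ext) = ⟨a, 0, 0, a⟩ :=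
  LinkingAlgebra.ext rfl rfl (map_zero X.sharp) rfl

theorem hasIndex : HasIndex (incl : A →⋆ₐ[ℂ] X.Ext) expect 2 := by
  obtain ⟨n, x, y, h⟩ := X.exists_sum_linner_eq_one
  have hx : ∀ z, ∑ i, op (X.rinner (y i) z) • x i = z := by
    intro z
    simp only [← X.linner_smul_eq, ← Finset.sum_smul, h, one_smul]
  have hy : ∀ z, ∑ i, X.linner z (X.sharp (x i)) • X.sharp (y i) = z := by
    intro z
    simp only [linner_sharp_smul, X.sharp_sharp, ← Finset.sum_smul, ← Finset.op_sum, h,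
      op_one, one_smul]
  -- The extra pair `(1, 1)` reproduces the diagonal part, the other pairs the off-diagonal part;
  -- each contributes `1` to the index.
  refine ⟨n + 1, Fin.cons 1 fun i => off (x i), Fin.cons 1 fun i => off (X.sharp (y i)),
    ⟨fun m => ?_, fun m => ?_⟩, ?_⟩
  · rw [Fin.sum_univ_succ]
    refine Ext.ext ?_ ?_
    · simp [fst_sum, expect_apply, X.linner_zero_right]
    · simp [snd_sum, expect_apply, X.linner_sharp_sharp, hx]
  · rw [Fin.sum_univ_succ]
    refine Ext.ext ?_ ?_
    · simp [fst_sum, expect_apply, X.linner_zero_left]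
    · simp [snd_sum, expect_apply, hy]
  · rw [Fin.sum_univ_succ, ← one_add_one_eq_two]
    refine Ext.ext ?_ ?_
    · simp [fst_sum, X.sharp_sharp, h]
    · simp [snd_sum]

end Ext

/-- The pair `(B_X, E_X)`. -/
noncomputable def extension : IndexTwoExtension A where
  B := X.Ext
  ι := Ext.incl
  ι_injective _ _ h := congrArg Prod.fst h
  E := Ext.expect
  condExp := Ext.isConditionalExpectation
  index_two := Ext.hasIndex

/-- The tautological isomorphism from `X` onto the kernel of `E_X`. -/
noncomputable def extensionKernelIso : X.extension.KernelIso X where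
  ρ :=
    { toFun := Ext.off
      map_add' := fun x y => Ext.ext (add_zero (0 : A)).symm rfl
      map_smul' := fun z x => Ext.ext (smul_zero z).symm rfl }
  injective _ _ h := congrArg Prod.snd h
  range_eq := by
    ext m
    constructor
    · rintro ⟨x, rfl⟩
      rfl
    · intro hm
      exact ⟨m.2, Ext.ext (Eq.symm hm) rfl⟩
  map_smul_left a x := Ext.off_smul a x
  map_smul_right x a := Ext.off_op_smul x a
  linner_eq x y := by
    change _ = (Ext.off x * star (Ext.off y)).1
    simp [X.sharp_sharp]
  rinner_eq x y := by
    change _ = (star (Ext.off x) * Ext.off y).1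
    simp [X.linner_sharp_sharp]
  map_sharp x := Ext.ext (star_zero A).symm rfl

/-! ### Recovering `(B, E)` from its kernel bimodule -/

variable {X} {P : IndexTwoExtension A}

/-- If `X` is isomorphic to the kernel of `E`, then `(B, E)` is isomorphic to `(B_X, E_X)`. -/
theorem extension_equiv (k : P.KernelIso X) : X.extension.Equiv P := by
  -- This is where `B₋ B₋ ⊆ A` enters: it makes `(a, x) ↦ a + x` multiplicative.
  have hmul : ∀ x y, k.ρ x * k.ρ y = P.ι (X.linner x (X.sharp y)) := by
    intro x y
    rw [k.linner_eq, k.map_sharp, star_star, P.ι_E_mul (k.E_ρ x) (k.E_ρ y)]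
  let f : X.Ext →⋆ₐ[ℂ] P.B :=
    { toFun := fun m => P.ι m.1 + k.ρ m.2
      map_one' := by simp
      map_mul' := fun m n => by
        simp only [Ext.fst_mul, Ext.snd_mul, map_add, map_mul, k.map_smul_left, k.map_smul_right,
          mul_add, add_mul, hmul]
        abel
      map_zero' := by simp
      map_add' := fun m n => by simp only [Ext.fst_add, Ext.snd_add, map_add]; abel
      commutes' := fun z => by
        rw [Algebra.algebraMap_eq_smul_one, Algebra.algebraMap_eq_smul_one]
        simp
      map_star' := fun m => by simp [k.map_sharp, map_star] }
  have hE : ∀ m, P.E (f m) = m.1 := fun m => by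
    change P.E (P.ι m.1 + k.ρ m.2) = _
    simp [k.E_ρ]
  have hf : Function.Bijective f := by
    constructor
    · intro m n h
      have h1 : m.1 = n.1 := by rw [← hE, h, hE]
      have h2 : P.ι m.1 + k.ρ m.2 = P.ι n.1 + k.ρ n.2 := h
      rw [h1] at h2
      exact Ext.ext h1 (k.injective (add_left_cancel h2))
    · intro b
      obtain ⟨x, hx⟩ := k.exists_ρ_eq (b := b - P.ι (P.E b)) (by simp)
      exact ⟨(P.E b, x), by change P.ι (P.E b) + k.ρ x = b; rw [hx]; abel⟩
  refine ⟨StarAlgEquiv.ofBijective f hf, fun a => ?_, hE⟩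
  change P.ι a + k.ρ 0 = _
  simp

/-- `toLinking` identifies `X.Ext` with the matrix algebra `B_X`. The norm condition is automatic,
because ⋆-isomorphisms of C⋆-algebras are isometric. -/
theorem nonempty_linkingIso_iff : Nonempty (X.LinkingIso P) ↔ X.extension.Equiv P := by
  constructor
  · rintro ⟨l⟩
    refine (IndexTwoExtension.setoid A).symm ?_
    have hl : ∀ b, ∃ m : X.Ext, Ext.toLinking m = l.π b := by
      intro b
      have : l.π b ∈ Set.range l.π := ⟨b, rfl⟩
      rw [l.range_eq] at this
      obtain ⟨a, x, h⟩ := this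
      exact ⟨(a, x), h.symm⟩
    choose g hg using hl
    have hgι : ∀ a, g (P.ι a) = Ext.incl a := fun a => Ext.toLinking_injective (by
      rw [hg, l.map_incl, Ext.toLinking_incl])
    let f : P.B →⋆ₐ[ℂ] X.Ext :=
      { toFun := g
        map_one' := by rw [← map_one P.ι, hgι, map_one]
        map_mul' := fun m n => Ext.toLinking_injective (by
          rw [hg, Ext.toLinking_mul, hg, hg, l.map_mul])
        map_zero' := by rw [← map_zero P.ι, hgι, map_zero]
        map_add' := fun m n => Ext.toLinking_injective (by
          rw [hg, Ext.toLinking_add, hg, hg, l.map_add])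
        commutes' := fun z => by rw [← AlgHomClass.commutes P.ι, hgι, AlgHomClass.commutes]
        map_star' := fun m => Ext.toLinking_injective (by
          rw [hg, Ext.toLinking_star, hg, l.map_star]) }
    have hf : Function.Bijective f := by
      constructor
      · intro b c h
        apply l.injective
        rw [← hg, ← hg]
        exact congrArg Ext.toLinking h
      · intro m
        have : Ext.toLinking m ∈ Set.range l.π := by
          rw [l.range_eq]
          exact ⟨m.1, m.2, rfl⟩
        obtain ⟨b, hb⟩ := this
        exact ⟨b, Ext.toLinking_injective ((hg b).trans hb)⟩
    refine ⟨StarAlgEquiv.ofBijective f hf, hgι, fun b => ?_⟩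
    have h := l.map_expectation b
    rw [l.map_incl, ← hg] at h
    exact (congrArg LinkingAlgebra.a h).symm
  · intro h
    obtain ⟨π, h1, h2⟩ := (IndexTwoExtension.setoid A).symm h
    let σ : P.B ≃⋆ₐ[ℂ] X.Ext := π
    have hσ : ∀ a, σ (P.ι a) = Ext.incl a := h1
    have hE : ∀ b, (σ b).1 = P.E b := h2
    exact ⟨{
      π := fun b => Ext.toLinking (σ b)
      map_add := fun b c => by rw [map_add, Ext.toLinking_add]
      map_smul := fun z b => by rw [map_smul, Ext.toLinking_smul]
      map_mul := fun b c => by rw [map_mul, Ext.toLinking_mul]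
      map_star := fun b => by rw [map_star, Ext.toLinking_star]
      isNorm := fun b => by
        rw [← StarAlgEquiv.norm_map σ b]
        exact Ext.isNorm_toLinking _
      injective := Ext.toLinking_injective.comp σ.injective
      range_eq := by
        ext m
        constructor
        · rintro ⟨b, rfl⟩
          exact ⟨_, _, rfl⟩
        · rintro ⟨a, x, rfl⟩
          obtain ⟨b, hb⟩ := σ.surjective (a, x)
          exact ⟨b, congrArg Ext.toLinking hb⟩
      map_incl := fun a => by rw [hσ, Ext.toLinking_incl]
      map_expectation := fun b => by
        rw [hσ, Ext.toLinking_incl, ← hE]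
        rfl }⟩

end InvolutiveBimodule

/-! ### The corner of the basic construction -/

namespace IndexTwoExtension

variable {A : Type u} [CStarAlgebra A] (P : IndexTwoExtension A)

@[simp] theorem lam_apply (b x : P.B) : P.lam b x = b * x := rfl

@[simp] theorem jones_apply (x : P.B) : P.jones x = P.ι (P.E x) := rfl

/-- Elements of the basic construction are right `A`-linear. -/
theorem basicConstruction_mul_ι {T : Module.End ℂ P.B} (hT : T ∈ P.basicConstruction) (x : P.B)
    (a : A) : T (x * P.ι a) = T x * P.ι a := by
  obtain ⟨n, u, v, hq, -⟩ := P.index_two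
  obtain ⟨C, hC0, hC⟩ := moduleNorm_equivalent P.condExp hq
  have hlin : ∀ S ∈ Submodule.span ℂ {R | ∃ b c, R = P.lam b * P.jones * P.lam c},
      S (x * P.ι a) = S x * P.ι a := by
    intro S hS
    induction hS using Submodule.span_induction with
    | mem S hS =>
      obtain ⟨b, c, rfl⟩ := hS
      simp [← mul_assoc]
    | zero => simp
    | add S S' _ _ h h' => simp [h, h', add_mul]
    | smul z S _ h => simp [h]
  -- An approximant `S` from the span is right `A`-linear, so the defect is that of `T - S`. The
  -- factor `C * C` comes from passing to the module norm and back.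
  have key : ∀ ε : ℝ, 0 < ε → ‖T (x * P.ι a) - T x * P.ι a‖
      ≤ ε * (C * C * (‖x * P.ι a‖ + ‖x‖ * ‖P.ι a‖)) := by
    intro ε hε
    obtain ⟨S, hS, h⟩ := hT ε hε
    have hb : ∀ y, ‖(T - S) y‖ ≤ ε * (C * C) * ‖y‖ := by
      intro y
      calc _ ≤ C * (ε * (C * ‖y‖)) := (hC _).2.trans (by
            gcongr; exact (h y).trans (by gcongr; exact (hC y).1))
        _ = _ := by ring
    have e : T (x * P.ι a) - T x * P.ι a = (T - S) (x * P.ι a) - (T - S) x * P.ι a := by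
      simp only [LinearMap.sub_apply, sub_mul, hlin S hS]
      abel
    rw [e]
    calc _ ≤ ε * (C * C) * ‖x * P.ι a‖ + ε * (C * C) * ‖x‖ * ‖P.ι a‖ :=
          norm_sub_le_of_le (hb _) ((norm_mul_le _ _).trans (by gcongr; exact hb x))
      _ = _ := by ring
  have h0 : ‖T (x * P.ι a) - T x * P.ι a‖ ≤ 0 := by
    refine le_of_forall_pos_le_add fun δ hδ => ?_
    rw [zero_add]
    set D := C * C * (‖x * P.ι a‖ + ‖x‖ * ‖P.ι a‖)
    have hD : 0 ≤ D := by positivity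
    refine (key (δ / (D + 1)) (by positivity)).trans ?_
    rw [div_mul_eq_mul_div, div_le_iff₀ (by positivity)]
    nlinarith
  exact sub_eq_zero.mp (norm_le_zero_iff.mp h0)

theorem jones_mul_lam_mem (b : P.B) : P.jones * P.lam b ∈ P.basicConstruction := by
  refine fun ε hε => ⟨P.jones * P.lam b, Submodule.subset_span ⟨1, b, ?_⟩, fun x => ?_⟩
  · ext x; simp
  · simp only [sub_self, LinearMap.zero_apply, moduleNorm, mul_zero, map_zero, norm_zero,
      Real.sqrt_zero]
    positivity

/-- The corner `e_A C⋆⟨B, e_A⟩ (1 - e_A)` consists of the operators `e_A b` with `b ∈ B₋`. -/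
theorem corner_eq : {T | ∃ S ∈ P.basicConstruction, T = P.jones * S * (1 - P.jones)}
    = {T | ∃ b, P.E b = 0 ∧ T = P.jones * P.lam b} := by
  ext T
  constructor
  · rintro ⟨S, hS, rfl⟩
    obtain ⟨n, u, v, hu, hv, h1, h2, h3⟩ := P.exists_kernel_quasiBasis
    -- Expand `x - E x = ∑ u i * E (v i * x)` and use right `A`-linearity of `S`: then `E (S (x - E
    -- x)) = E (b * x)` for this `b`.
    refine ⟨∑ i, P.ι (P.E (S (u i))) * v i, by simp [hv], LinearMap.ext fun x => ?_⟩
    have hx := h1 (x - P.ι (P.E x)) (by simp)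
    have hS' := P.basicConstruction_mul_ι hS
    have : P.E (S (x - P.ι (P.E x))) = ∑ i, P.E (S (u i)) * P.E (v i * x) := by
      rw [← hx]
      simp [mul_sub, hv, hS']
    simp only [Module.End.mul_apply, LinearMap.sub_apply, Module.End.one_apply, jones_apply,
      lam_apply, this, Finset.sum_mul, map_sum, mul_assoc, E_ι_mul]
  · rintro ⟨b, hb, rfl⟩
    refine ⟨P.jones * P.lam b, P.jones_mul_lam_mem b, LinearMap.ext fun x => ?_⟩
    simp [mul_sub, hb]

/-- Evaluation at `(b - c)⋆` gives `E ((b - c) (b - c)⋆) = 0`, and `E` is faithful. -/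
theorem jones_mul_lam_injective {b c : P.B} (h : P.jones * P.lam b = P.jones * P.lam c) :
    b = c := by
  have h1 := congrArg P.E (LinearMap.congr_fun h (star (b - c)))
  simp only [Module.End.mul_apply, jones_apply, lam_apply, E_ι] at h1
  rw [← sub_eq_zero, ← map_sub, ← sub_mul] at h1
  have := P.eq_zero_of_E_star_mul_self (x := star (b - c)) (by rwa [star_star])
  rwa [star_eq_zero, sub_eq_zero] at this

theorem isAdjoint_jones_mul_lam (b : P.B) :
    P.IsAdjoint (P.jones * P.lam b) (P.lam (star b) * P.jones) := by
  intro x y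
  simp only [Module.End.mul_apply, jones_apply, lam_apply, ← map_star, E_ι_mul, ← E_star,
    star_mul, ← mul_assoc, E_mul_ι]

theorem IsAdjoint.unique {P : IndexTwoExtension A} {T S S' : Module.End ℂ P.B}
    (h : P.IsAdjoint T S) (h' : P.IsAdjoint T S') : S = S' := by
  refine LinearMap.ext fun y => sub_eq_zero.mp (P.eq_zero_of_E_star_mul_self ?_)
  rw [mul_sub, map_sub, ← h, ← h', sub_self]

/-- Both `b` and `x - E x` lie in `B₋`, so their product lies in `A` and is fixed by `E`.
Consequently `β̂` sends `(e_A b)⋆ = b⋆ e_A` to `b⋆ (1 - e_A) = e_A b⋆`, which matches `♯` with the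
star of `B₋`. -/
theorem lam_one_sub_jones {b : P.B} (hb : P.E b = 0) :
    P.lam b * (1 - P.jones) = P.jones * P.lam b := by
  refine LinearMap.ext fun x => ?_
  have := P.ι_E_mul (x := b) (y := x - P.ι (P.E x)) hb (by simp)
  change b * (x - P.ι (P.E x)) = P.ι (P.E (b * x))
  rw [← this]
  simp [mul_sub, hb]

theorem lam_mul_jones_mul_lam {b c : P.B} (hb : P.E b = 0) (hc : P.E c = 0) :
    P.lam b * P.jones * P.lam c = P.lam (P.ι (P.E (b * c))) * (1 - P.jones) := by
  rw [mul_assoc, ← P.lam_one_sub_jones hc, ← mul_assoc, P.ι_E_mul hb hc]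
  ext x
  simp [mul_assoc]

/-- Such a `b` annihilates `B₋` from the left, and `B₋ B₋` spans `1` by `∑ u i * v i = 1`. -/
theorem eq_zero_of_lam_one_sub_jones {b : P.B} (h : P.lam b * (1 - P.jones) = 0) : b = 0 := by
  obtain ⟨n, u, v, hu, hv, h1, h2, h3⟩ := P.exists_kernel_quasiBasis
  have h0 : ∀ i, b * u i = 0 := fun i => by
    simpa [hu] using LinearMap.congr_fun h (u i)
  rw [← mul_one b, ← h3, Finset.mul_sum]
  exact Finset.sum_eq_zero fun i _ => by rw [← mul_assoc, h0, zero_mul]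

theorem isDualAction_lam_mul_jones (b : P.B) :
    P.IsDualAction (P.lam b * P.jones) (P.lam b * (1 - P.jones)) := by
  -- Since `U = 2 e_A - 1`, one has `e_A = (1 + U) / 2` and `1 - e_A = (1 - U) / 2`.
  refine ⟨(2⁻¹ : ℂ) • b, (2⁻¹ : ℂ) • b, LinearMap.ext fun x => ?_, LinearMap.ext fun x => ?_⟩ <;>
  · simp only [Module.End.mul_apply, LinearMap.add_apply, LinearMap.sub_apply, two_mul,
      Module.End.one_apply, jones_apply, lam_apply, smul_mul_assoc, mul_sub, mul_add]
    module

/-- The dual action is a well-defined map. -/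
theorem IsDualAction.unique {P : IndexTwoExtension A} {T S S' : Module.End ℂ P.B}
    (h : P.IsDualAction T S) (h' : P.IsDualAction T S') : S = S' := by
  obtain ⟨b, c, h1, rfl⟩ := h
  obtain ⟨b', c', h1', rfl⟩ := h'
  rw [h1] at h1'
  -- The operator `b + c U` is multiplication by `b + c` on `A` and by `b - c` on `B₋`, so it
  -- determines both.
  have e1 : b + c = b' + c' := by
    have := LinearMap.congr_fun h1' 1
    simpa [two_mul] using this
  have e2 : b - c = b' - c' := by
    rw [← sub_eq_zero]
    apply P.eq_zero_of_lam_one_sub_jones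
    refine LinearMap.ext fun x => ?_
    have := LinearMap.congr_fun h1' (x - P.ι (P.E x))
    simp only [two_mul, Module.End.mul_apply, LinearMap.add_apply, LinearMap.sub_apply,
      Module.End.one_apply, jones_apply, lam_apply, map_sub, E_ι] at this ⊢
    simp only [LinearMap.zero_apply]
    rw [← sub_eq_zero] at this
    rw [← this]
    noncomm_ring
  have e3 : b = b' := by
    have : (2 : ℂ) • b = (2 : ℂ) • b' := by
      calc _ = (b + c) + (b - c) := by module
        _ = _ := by rw [e1, e2]; module
    exact smul_right_injective P.B two_ne_zero this
  rw [e3] at e1 ⊢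
  rw [add_left_cancel e1]

variable {P} {X : InvolutiveBimodule A}

/-- `B₋ ≅ X_B` through `b ↦ e_A b`. -/
noncomputable def KernelIso.toCornerIso (k : P.KernelIso X) : P.CornerIso X where
  ρ := LinearMap.mulLeft ℂ P.jones ∘ₗ LinearMap.mul ℂ P.B ∘ₗ k.ρ
  ρadj x := P.lam (star (k.ρ x)) * P.jones
  isAdjoint x := P.isAdjoint_jones_mul_lam _
  injective x y h := k.injective (P.jones_mul_lam_injective h)
  range_eq := by
    rw [corner_eq]
    ext T
    constructor
    · rintro ⟨x, rfl⟩
      exact ⟨k.ρ x, k.E_ρ x, rfl⟩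
    · rintro ⟨b, hb, rfl⟩
      obtain ⟨x, rfl⟩ := k.exists_ρ_eq hb
      exact ⟨x, rfl⟩
  map_smul_left a x := by
    change P.jones * P.lam (k.ρ (a • x)) = P.lam (P.ι a) * (P.jones * P.lam (k.ρ x))
    rw [k.map_smul_left]
    ext y
    simp [mul_assoc]
  map_smul_right x a := by
    change P.jones * P.lam (k.ρ (op a • x)) = P.jones * P.lam (k.ρ x) * P.lam (P.ι a)
    rw [k.map_smul_right]
    ext y
    simp [mul_assoc]
  linner_eq x y := by
    change _ = P.jones * P.lam (k.ρ x) * (P.lam (star (k.ρ y)) * P.jones)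
    rw [k.linner_eq]
    ext z
    simp [← mul_assoc]
  rinner_eq x y := by
    change _ = P.lam (star (k.ρ x)) * P.jones * (P.jones * P.lam (k.ρ y))
    rw [k.rinner_eq, ← P.lam_mul_jones_mul_lam (by rw [E_star, k.E_ρ, star_zero]) (k.E_ρ y)]
    ext z
    simp
  map_sharp x := by
    change P.IsDualAction _ (P.jones * P.lam (k.ρ (X.sharp x)))
    rw [k.map_sharp, ← P.lam_one_sub_jones (by rw [E_star, k.E_ρ, star_zero])]
    exact P.isDualAction_lam_mul_jones _

/-- Every corner element is `e_A b` for a unique `b ∈ B₋`. Uniqueness of adjoints and of the dual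
action then forces the structure on `X` to be that of `B₋`. -/
theorem CornerIso.nonempty_kernelIso (c : P.CornerIso X) : Nonempty (P.KernelIso X) := by
  have hex : ∀ x, ∃ b, P.E b = 0 ∧ c.ρ x = P.jones * P.lam b := by
    intro x
    have : c.ρ x ∈ Set.range c.ρ := ⟨x, rfl⟩
    rw [c.range_eq, corner_eq] at this
    exact this
  choose r hr hρ using hex
  have hadj : ∀ x, c.ρadj x = P.lam (star (r x)) * P.jones := fun x =>
    (c.isAdjoint x).unique (by rw [hρ]; exact P.isAdjoint_jones_mul_lam _)
  refine ⟨{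
    ρ :=
      { toFun := r
        map_add' := fun x y => P.jones_mul_lam_injective (by
          rw [← hρ, map_add, hρ, hρ]; ext z; simp [add_mul])
        map_smul' := fun a x => P.jones_mul_lam_injective (by
          rw [← hρ, map_smul, hρ]; ext z; simp) }
    injective := fun x y h => c.injective (by
      rw [hρ, hρ]; exact congrArg (fun b => P.jones * P.lam b) h)
    range_eq := ?_
    map_smul_left := fun a x => P.jones_mul_lam_injective (by
      change P.jones * P.lam (r _) = P.jones * P.lam (_ * r _)
      rw [← hρ, c.map_smul_left, hρ]; ext z; simp [mul_assoc])
    map_smul_right := fun x a => P.jones_mul_lam_injective (by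
      change P.jones * P.lam (r _) = P.jones * P.lam (r _ * _)
      rw [← hρ, c.map_smul_right, hρ]; ext z; simp [mul_assoc])
    linner_eq := fun x y => ?_
    rinner_eq := fun x y => ?_
    map_sharp := fun x => P.jones_mul_lam_injective ?_ }⟩
  · ext b
    constructor
    · rintro ⟨x, rfl⟩
      exact hr x
    · intro hb
      have : P.jones * P.lam b ∈ Set.range c.ρ := by
        rw [c.range_eq, corner_eq]
        exact ⟨b, hb, rfl⟩
      obtain ⟨x, hx⟩ := this
      exact ⟨x, P.jones_mul_lam_injective ((hρ x).symm.trans hx)⟩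
  -- Evaluation at `1`, which `e_A` fixes, recovers the left inner product.
  · have := congrArg P.E (LinearMap.congr_fun (c.linner_eq x y) 1)
    rw [hρ, hadj] at this
    simpa using this
  · have h := c.rinner_eq x y
    have e : P.lam (star (r x)) * P.jones * (P.jones * P.lam (r y))
        = P.lam (star (r x)) * P.jones * P.lam (r y) := by
      ext z; simp
    rw [hρ, hadj, e, P.lam_mul_jones_mul_lam (by rw [E_star, hr, star_zero]) (hr y),
      ← sub_eq_zero] at h
    apply P.ι_injective
    rw [← sub_eq_zero]
    apply P.eq_zero_of_lam_one_sub_jones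
    rw [← h]
    ext z
    simp [sub_mul]
  · change P.jones * P.lam (r _) = P.jones * P.lam (star (r x))
    have h := c.map_sharp x
    rw [hadj] at h
    rw [← hρ, ← P.lam_one_sub_jones (by rw [E_star, hr, star_zero])]
    exact h.unique (P.isDualAction_lam_mul_jones _)

theorem nonempty_cornerIso_iff : Nonempty (P.CornerIso X) ↔ Nonempty (P.KernelIso X) :=
  ⟨fun ⟨c⟩ => c.nonempty_kernelIso, fun ⟨k⟩ => ⟨k.toCornerIso⟩⟩

end IndexTwoExtension

/-! ### The bijection of isomorphism classes -/

open IndexTwoExtension InvolutiveBimodule in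
/-- The bijection `[B, E] ↦ [B₋]`, with inverse `[X] ↦ [B_X, E_X]`. -/
noncomputable def indexTwoEquiv (A : Type u) [CStarAlgebra A] :
    Quotient (IndexTwoExtension.setoid A) ≃ Quotient (InvolutiveBimodule.setoid A) where
  toFun := Quotient.map kernelBimodule fun P Q h => by
    obtain ⟨k⟩ := P.kernelIso.congr_left h
    exact k.equiv Q.kernelIso
  invFun := Quotient.map extension fun X Y h => by
    obtain ⟨k⟩ := X.extensionKernelIso.congr_right h
    exact (IndexTwoExtension.setoid A).symm (extension_equiv k)
  left_inv := by
    rintro ⟨P⟩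
    exact Quotient.sound (extension_equiv P.kernelIso)
  right_inv := by
    rintro ⟨X⟩
    exact Quotient.sound (X.extension.kernelIso.equiv X.extensionKernelIso)

theorem indexTwoEquiv_mk_eq_iff {A : Type u} [CStarAlgebra A] (P : IndexTwoExtension A)
    (X : InvolutiveBimodule A) :
    indexTwoEquiv A (Quotient.mk _ P) = Quotient.mk _ X ↔ Nonempty (P.KernelIso X) :=
  Quotient.eq.trans ⟨fun h => P.kernelIso.congr_right h, fun ⟨k⟩ => P.kernelIso.equiv k⟩

theorem theorem3p3p1 (A : Type u) [CStarAlgebra A] :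
    ∃ Φ : Quotient (IndexTwoExtension.setoid A) ≃ Quotient (InvolutiveBimodule.setoid A),
      (∀ (P : IndexTwoExtension A) (X : InvolutiveBimodule A),
        Φ (Quotient.mk _ P) = Quotient.mk _ X ↔ Nonempty (P.CornerIso X)) ∧
      (∀ (P : IndexTwoExtension A) (X : InvolutiveBimodule A),
        Φ (Quotient.mk _ P) = Quotient.mk _ X ↔ Nonempty (P.KernelIso X)) ∧
      (∀ (X : InvolutiveBimodule A) (P : IndexTwoExtension A),
        Φ.symm (Quotient.mk _ X) = Quotient.mk _ P ↔ Nonempty (X.LinkingIso P)) := by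
  refine ⟨indexTwoEquiv A, fun P X => ?_, indexTwoEquiv_mk_eq_iff, fun X P => ?_⟩
  · rw [indexTwoEquiv_mk_eq_iff, IndexTwoExtension.nonempty_cornerIso_iff]
  · rw [InvolutiveBimodule.nonempty_linkingIso_iff]
    exact Quotient.eq
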